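/- Let $\mathbb K=\mathbb R$ or $\mathbb C$, let $n\ge 2$ and $m\ge 1$, let $G=GL_n(\mathbb K)$, and let $P\subset G$ be the maximal parabolic subgroup with $G/P\cong\mathbb P^{n-1}\mathbb K$. Identify $G^m/P^m$ with $(\mathbb P^{n-1}\mathbb K)^m$, on which $G$ acts diagonally. An *$m$-tuple flag* is a tuple $(V;V^{(1)},\dots,V^{(m)})$ of a finite-dimensional $\mathbb K$-vector space $V$ and subspaces $V^{(i)}\subset V$. Its dimension is $(\dim V;\dim V^{(1)},\dots,\dim V^{(m)})$. Isomorphisms are linear isomorphisms of the whole spaces carrying the $i$-th subspace onto the $i$-th subspace for every $i$. Direct sums are formed componentwise. A flag is *indecomposable* if it is not isomorphic to a direct sum of two flags with non-zero whole spaces. A point of $(\mathbb P^{n-1}\mathbb K)^m$ is an $m$-tuple flag with whole space $\mathbb K^n$, and two such points lie in the same $\mathrm{diag}(G)$-orbit if and only if they are isomorphic. For $K\subset\{1,\dots,m\}$ and $r\in\mathbb N$ put $\mathbf d(K,r)=(r;\delta_{1,K},\dots,\delta_{m,K})$, where $\delta_{i,K}=1$ if $i\in K$ and $0$ otherwise.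 Let $\mathcal P_{n,m}$ be the set of all $p=(\{I_a\}_{a=1}^A,\{J_b\}_{b=1}^B,\{(K_c,r_c)\}_{c=1}^C)$ (unordered families) such that the $I_a,J_b,K_c$ form a partition of $\{1,\dots,m\}$, $\#I_a\ge1$, $\#J_b\ge3$, $r_c\in\mathbb N$, $4\le r_c+2\le\#K_c$, and $r(p):=A+\sum_b(\#J_b-1)+\sum_c r_c\le n$. A flag is *$p$-constructible* if it is isomorphic to a direct sum of indecomposable flags: $n-r(p)$ of dimension $\mathbf d(\emptyset,1)$, and one of each of the dimensions $\mathbf d(I_a,1)$, $\mathbf d(J_b,\#J_b-1)$, $\mathbf d(K_c,r_c)$. Each $F\in G^m/P^m$ is $p_F$-constructible for exactly one $p_F\in\mathcal P_{n,m}$, and $\pi\colon\mathrm{diag}(G)\backslash G^m/P^m\to\mathcal P_{n,m}$, $\mathrm{diag}(G)\cdot F\mapsto p_F$, is a well-defined surjection. Let $e_1,e_2,\dots$ denote standard basis vectors. Define flags as follows; subspaces that are not mentioned are $0$. - For $I\subset\{1,\dots,m\}$, $F(I)$ has whole space $\mathbb K$, and its $i$-th subspace is $\mathbb K$ for $i\in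 I$. - For $J=\{j_1<\dots<j_{r+1}\}$ with $r\ge2$, $D(J)$ has whole space $\mathbb K^r$, its $j_h$-th subspace is $\mathbb Ke_h$ for $h\le r$, and its $j_{r+1}$-th subspace is $\mathbb K\sum_{h=1}^re_h$. - For $K=\{k_1<\dots<k_{\#K}\}$, $4\le r+2\le\#K$ and $q=(q^{(r+2)},\dots,q^{(\#K)})\in(\mathbb P^{r-1}\mathbb K)^{\#K-r-1}$, $E(K,r,q)$ has whole space $\mathbb K^r$, its $k_h$-th subspace is $\mathbb Ke_h$ for $h\le r$, its $k_{r+1}$-th is $\mathbb K\sum_{h=1}^re_h$, and its $k_h$-th is the line $q^{(h)}$ for $h\ge r+2$. For $p\in\mathcal P_{n,m}$ and $q=(q_c)_c\in\prod_{c=1}^C(\mathbb P^{r_c-1}\mathbb K)^{\#K_c-r_c-1}$ put $$F(p,q)=F(\emptyset)^{\oplus(n-r(p))}\oplus\bigoplus_{a=1}^AF(I_a)\oplus\bigoplus_{b=1}^BD(J_b)\oplus\bigoplus_{c=1}^CE(K_c,r_c,q_c),$$ and let $\mathrm{diag}(G)\cdot F(p,q)$ be the orbit of all points of $G^m/P^m$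 that are isomorphic to $F(p,q)$. **Theorem.** For each $p\in\mathcal P_{n,m}$ the map $$\iota_p\colon\prod_{c=1}^C(\mathbb P^{r_c-1}\mathbb K)^{\#K_c-r_c-1}\to\pi^{-1}(p),\qquad q\mapsto\mathrm{diag}(G)\cdot F(p,q),$$ is well defined and is an open dense embedding (a homeomorphism onto an open dense subset). Here projective spaces carry their usual topology, $\mathrm{diag}(G)\backslash G^m/P^m$ carries the quotient topology, and $\pi^{-1}(p)$ carries the subspace topology. If $C=0$, then $\pi^{-1}(p)$ is a single orbit, and $\iota_p$ is a bijection between singletons. -/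

import Mathlib

open scoped LinearAlgebra.Projectivization

universe u

/-- Projective space carries the quotient topology from the nonzero vectors. -/
instance Projectivization.instTopologicalSpaceQuot (𝕜 V : Type*) [DivisionRing 𝕜] [AddCommGroup V]
    [Module 𝕜 V] [TopologicalSpace V] : TopologicalSpace (ℙ 𝕜 V) :=
  inferInstanceAs (TopologicalSpace (Quotient (projectivizationSetoid 𝕜 V)))

/-! ### Tuples of subspaces -/

/-- An `m`-tuple flag `(V; V⁽¹⁾, …, V⁽ᵐ⁾)`: a finite-dimensional vector space with `m` subspaces. -/
structure MultiFlag (𝕜 : Type u) [Field 𝕜] (m : ℕ) where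
  /-- the whole space -/
  V : Type u
  [instAddCommGroup : AddCommGroup V]
  [instModule : Module 𝕜 V]
  [instFinite : FiniteDimensional 𝕜 V]
  /-- the subspaces -/
  sub : Fin m → Submodule 𝕜 V

namespace MultiFlag

attribute [instance] instAddCommGroup instModule instFinite

variable {𝕜 : Type u} [Field 𝕜] {m : ℕ}

/-- The dimension `(dim V; dim V⁽¹⁾, …, dim V⁽ᵐ⁾)`. -/
noncomputable def dim (D : MultiFlag 𝕜 m) : ℕ × (Fin m → ℕ) :=
  (Module.finrank 𝕜 D.V, fun i => Module.finrank 𝕜 (D.sub i))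

/-- The dimension vector `d(K, r) = (r; δ_{1,K}, …, δ_{m,K})`. -/
def dimVec (K : Finset (Fin m)) (r : ℕ) : ℕ × (Fin m → ℕ) :=
  (r, fun i => if i ∈ K then 1 else 0)

/-- Isomorphism of `m`-tuple flags. -/
def Iso (D E : MultiFlag 𝕜 m) : Prop :=
  ∃ f : D.V ≃ₗ[𝕜] E.V, ∀ i, (D.sub i).map f.toLinearMap = E.sub i

/-- The direct sum of two `m`-tuple flags. -/
abbrev prod (D E : MultiFlag 𝕜 m) : MultiFlag 𝕜 m where
  V := D.V × E.V
  sub i := (D.sub i).prod (E.sub i)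

/-- The direct sum of a finite family of `m`-tuple flags. -/
abbrev directSum {ι : Type} [Finite ι] (D : ι → MultiFlag 𝕜 m) : MultiFlag 𝕜 m where
  V := ∀ x, (D x).V
  sub i := Submodule.pi Set.univ fun x => (D x).sub i

/-- A flag is trivial if its dimension is `(0; 0, …, 0)`. -/
def IsTrivial (D : MultiFlag 𝕜 m) : Prop := D.dim = (0, fun _ => 0)

/-- A flag is indecomposable if it is not isomorphic to a direct sum of two nontrivial flags. -/
def Indecomposable (D : MultiFlag 𝕜 m) : Prop :=
  ∀ D₁ D₂ : MultiFlag 𝕜 m, D.Iso (D₁.prod D₂) → D₁.IsTrivial ∨ D₂.IsTrivial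

/-- The subspaces of `F(I)`: the `i`-th subspace of `𝕜` is `𝕜` if `i ∈ I` and `0` otherwise. -/
def subF (𝕜 : Type u) [Field 𝕜] {m : ℕ} (I : Finset (Fin m)) (i : Fin m) : Submodule 𝕜 𝕜 :=
  if i ∈ I then ⊤ else ⊥

/-- The flag `F(I)` on `𝕜`. -/
abbrev flagF (𝕜 : Type u) [Field 𝕜] {m : ℕ} (I : Finset (Fin m)) : MultiFlag 𝕜 m where
  V := 𝕜
  sub := subF 𝕜 I

/-- The position (counted from `0`) of `i` in the increasing enumeration of `K`. -/
def position (K : Finset (Fin m)) (i : Fin m) (hi : i ∈ K) : Fin K.card :=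
  (K.orderIsoOfFin rfl).symm ⟨i, hi⟩

/-- The subspaces of `D(J)`: for `J = {j_0 < ⋯ < j_r}` with `r = #J - 1`, the subspace of `𝕜^r` at
`j_h` is `𝕜 e_h` for `h < r`, the one at `j_r` is `𝕜 (1, …, 1)`, and the others are `0`. -/
def subD (𝕜 : Type u) [Field 𝕜] {m : ℕ} (J : Finset (Fin m)) (i : Fin m) :
    Submodule 𝕜 (Fin (J.card - 1) → 𝕜) :=
  if hi : i ∈ J then
    if h : (position J i hi : ℕ) < J.card - 1 then
      𝕜 ∙ (Pi.single (⟨position J i hi, h⟩ : Fin (J.card - 1)) (1 : 𝕜))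
    else 𝕜 ∙ (fun _ : Fin (J.card - 1) => (1 : 𝕜))
  else ⊥

/-- The flag `D(J)` on `𝕜^(#J - 1)`. -/
abbrev flagD (𝕜 : Type u) [Field 𝕜] {m : ℕ} (J : Finset (Fin m)) : MultiFlag 𝕜 m where
  V := Fin (J.card - 1) → 𝕜
  sub := subD 𝕜 J

/-- The subspaces of `E(K, r, q)`: for `K = {k_0 < k_1 < ⋯}`, the subspace of `𝕜^r` at `k_h` is
`𝕜 e_h` for `h < r`, the one at `k_r` is `𝕜 (1, …, 1)`, the one at `k_h` for `h > r` is the line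
`q_(h - r - 1)`, and the others are `0`. -/
def subE {𝕜 : Type u} [Field 𝕜] {m : ℕ} (K : Finset (Fin m)) (r : ℕ)
    (q : Fin (K.card - r - 1) → ℙ 𝕜 (Fin r → 𝕜)) (i : Fin m) : Submodule 𝕜 (Fin r → 𝕜) :=
  if hi : i ∈ K then
    if h : (position K i hi : ℕ) < r then
      𝕜 ∙ (Pi.single (⟨position K i hi, h⟩ : Fin r) (1 : 𝕜))
    else if h' : (position K i hi : ℕ) = r then
      𝕜 ∙ (fun _ : Fin r => (1 : 𝕜))
    else
      (q ⟨position K i hi - r - 1, by have := (position K i hi).isLt; omega⟩).submodule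
  else ⊥

/-- The flag `E(K, r, q)` on `𝕜^r`. -/
abbrev flagE {𝕜 : Type u} [Field 𝕜] {m : ℕ} (K : Finset (Fin m)) (r : ℕ)
    (q : Fin (K.card - r - 1) → ℙ 𝕜 (Fin r → 𝕜)) : MultiFlag 𝕜 m where
  V := Fin r → 𝕜
  sub := subE K r q

/-- An `m`-tuple of points of `ℙ^(n-1)`, regarded as an `m`-tuple flag on `𝕜^n`. -/
abbrev ofPoints {n : ℕ} (x : Fin m → ℙ 𝕜 (Fin n → 𝕜)) : MultiFlag 𝕜 m where
  V := Fin n → 𝕜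
  sub i := (x i).submodule

end MultiFlag

/-! ### The finite set `P_{n,m}` -/

/-- The elements `({I_a}, {J_b}, {(K_c, r_c)})` of `P_{n,m}`. The blocks are nonempty and disjoint,
hence distinct, so the families are recorded as finite sets. -/
structure SplitType (n m : ℕ) where
  I : Finset (Finset (Fin m))
  J : Finset (Finset (Fin m))
  K : Finset (Finset (Fin m) × ℕ)
  /-- The blocks `I_a, J_b, K_c` form a partition of the `m`-element index set. -/
  partition : ∀ i : Fin m, ∃! b : I ⊕ J ⊕ K,
    i ∈ Sum.elim (fun a => a.1) (Sum.elim (fun b => b.1) (fun c => c.1.1)) b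
  card_I : ∀ s ∈ I, 1 ≤ s.card
  card_J : ∀ s ∈ J, 3 ≤ s.card
  card_K : ∀ c ∈ K, 4 ≤ c.2 + 2 ∧ c.2 + 2 ≤ c.1.card
  /-- `r(p) ≤ n` -/
  rank_le : I.card + ∑ s ∈ J, (s.card - 1) + ∑ c ∈ K, c.2 ≤ n

namespace SplitType

variable {n m : ℕ}

/-- `r(p) = A + ∑ (#J_b - 1) + ∑ r_c`. -/
def rank (p : SplitType n m) : ℕ := p.I.card + ∑ s ∈ p.J, (s.card - 1) + ∑ c ∈ p.K, c.2

/-- The index set of the summands: `n - r(p)` empty ones, then the `I_a`, the `J_b`, the `K_c`. -/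
abbrev Index (p : SplitType n m) : Type := Fin (n - p.rank) ⊕ p.I ⊕ p.J ⊕ p.K

/-- The prescribed dimensions of the summands. -/
def summandDim (p : SplitType n m) : p.Index → ℕ × (Fin m → ℕ)
  | .inl _ => MultiFlag.dimVec ∅ 1
  | .inr (.inl a) => MultiFlag.dimVec a.1 1
  | .inr (.inr (.inl b)) => MultiFlag.dimVec b.1 (b.1.card - 1)
  | .inr (.inr (.inr c)) => MultiFlag.dimVec c.1.1 c.1.2

/-- `F` is `p`-constructible if it is isomorphic to a direct sum of indecomposable flags with the
dimensions prescribed by `p`. -/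
def IsConstructible {𝕜 : Type u} [Field 𝕜] (p : SplitType n m) (F : MultiFlag 𝕜 m) : Prop :=
  ∃ S : p.Index → MultiFlag 𝕜 m,
    (∀ x, (S x).dim = p.summandDim x ∧ (S x).Indecomposable) ∧ F.Iso (MultiFlag.directSum S)

/-- The parameter space `∏_c (ℙ^(r_c - 1))^(#K_c - r_c - 1)`. -/
abbrev Param (𝕜 : Type u) [Field 𝕜] (p : SplitType n m) : Type u :=
  ∀ c : p.K, Fin (c.1.1.card - c.1.2 - 1) → ℙ 𝕜 (Fin c.1.2 → 𝕜)

/-- The summands of `F(p, q)`. -/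
def repSummand {𝕜 : Type u} [Field 𝕜] (p : SplitType n m) (q : p.Param 𝕜) :
    p.Index → MultiFlag 𝕜 m
  | .inl _ => MultiFlag.flagF 𝕜 ∅
  | .inr (.inl a) => MultiFlag.flagF 𝕜 a.1
  | .inr (.inr (.inl b)) => MultiFlag.flagD 𝕜 b.1
  | .inr (.inr (.inr c)) => MultiFlag.flagE c.1.1 c.1.2 (q c)

/-- The flag `F(p, q)`, the direct sum of `F(∅)^(n - r(p))`, the `F(I_a)`, the `D(J_b)` and the
`E(K_c, r_c, q_c)`. -/
def rep {𝕜 : Type u} [Field 𝕜] (p : SplitType n m) (q : p.Param 𝕜) : MultiFlag 𝕜 m :=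
  MultiFlag.directSum (p.repSummand q)

end SplitType

/-- The orbit space `diag(G) \ (ℙ^(n-1))^m` for the diagonal action of `G = GL(𝕜^n)`, where
`G^m / P^m` is `(ℙ^(n-1))^m`. -/
abbrev OrbitSpace (𝕜 : Type u) [Field 𝕜] (n m : ℕ) : Type u :=
  MulAction.orbitRel.Quotient (LinearMap.GeneralLinearGroup 𝕜 (Fin n → 𝕜))
    (Fin m → ℙ 𝕜 (Fin n → 𝕜))

/-- The orbit of a point. -/
def orbitOf {𝕜 : Type u} [Field 𝕜] {n m : ℕ} (x : Fin m → ℙ 𝕜 (Fin n → 𝕜)) : OrbitSpace 𝕜 n m :=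
  Quotient.mk _ x

/-! The type of a tuple of lines is read off from its separators: index sets `B` for which some
endomorphism of the whole space is the identity on the lines in `B` and kills the others. Separators
are closed under complement and intersection, so the minimal ones (`sepBlock`) partition the index
set. Their spans are independent and the flag restricted to each span is indecomposable, which gives
a decomposition (`isConstructible_of_sepBlocks`). Conversely, in any decomposition of the prescribed
shape the blocks are the minimal separators and the ranks are the dimensions of their spans
(`blk_eq_sepBlock`, `rk_eq_finrank`). This gives uniqueness of the type without a Krull–Schmidt
theorem. Independent lines split into singletons, so a minimal separator has rank one, or rank ρ ≥ 2
and at least ρ + 1 lines; this is the trichotomy I, J, K.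

Summands of types ∅, I and J are determined by their dimensions: in type J, all relations between
the lines have full support, so the lines form a projective frame (`Indecomposable.iso_flagD`). A
K-summand is some `E(K, r, q)` exactly when its first r + 1 lines form a projective frame. A linear
map preserving every line of the standard frame is a scalar, so q is an invariant and ι is injective
(`rep_injective`).

For the topology: F(p, q) can be placed in a fixed 𝕜ⁿ so that only the lines belonging to q move,
which gives continuity (`exists_continuous_points`). The frame condition is open, and where it holds
Cramer's rule expresses q continuously in spanning vectors of the lines, so ι is open onto its image
within the fibre (`eventually_exists_iso_rep`). Finally, moving the lines of each K-summand inside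
that summand keeps the type, and a generic small move produces a frame because the relevant
determinants are non-zero polynomials in the step size; hence the image is dense
(`exists_iso_rep_mem`). -/

namespace MultiFlag

variable {𝕜 : Type u} [Field 𝕜] {m : ℕ}

/-! ### Isomorphisms -/

theorem Iso.refl (D : MultiFlag 𝕜 m) : D.Iso D :=
  ⟨LinearEquiv.refl _ _, fun _ => Submodule.map_id _⟩

theorem Iso.symm {D E : MultiFlag 𝕜 m} (h : D.Iso E) : E.Iso D := by
  obtain ⟨f, hf⟩ := h
  refine ⟨f.symm, fun i => ?_⟩
  rw [← hf i, ← Submodule.map_comp]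
  simp

theorem Iso.trans {D E F : MultiFlag 𝕜 m} (h : D.Iso E) (h' : E.Iso F) : D.Iso F := by
  obtain ⟨f, hf⟩ := h
  obtain ⟨g, hg⟩ := h'
  refine ⟨f.trans g, fun i => ?_⟩
  rw [← hg i, ← hf i, ← Submodule.map_comp]
  rfl

theorem Iso.directSum {ι : Type} [Finite ι] {S S' : ι → MultiFlag 𝕜 m}
    (h : ∀ y, (S y).Iso (S' y)) : (directSum S).Iso (directSum S') := by
  choose f hf using h
  refine ⟨LinearEquiv.piCongrRight f, fun i => ?_⟩
  ext w
  simp only [Submodule.mem_map, Submodule.mem_pi, Set.mem_univ, true_imp_iff]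
  constructor
  · rintro ⟨v, hv, rfl⟩ y
    rw [← hf y i]
    exact Submodule.mem_map_of_mem (hv y)
  · intro hw
    refine ⟨fun y => (f y).symm (w y), fun y => ?_, by ext y; simp⟩
    have := hw y
    rw [← hf y i] at this
    obtain ⟨v, hv, hvw⟩ := this
    simpa [← hvw] using hv

theorem mem_sub_iff_of_map_eq {D E : MultiFlag 𝕜 m} {f : D.V ≃ₗ[𝕜] E.V} {i : Fin m}
    (hf : (D.sub i).map f.toLinearMap = E.sub i) (v : D.V) : f v ∈ E.sub i ↔ v ∈ D.sub i := by
  rw [← hf]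
  constructor
  · rintro ⟨w, hw, hwv⟩
    rwa [← f.injective hwv]
  · exact fun h => Submodule.mem_map_of_mem h

/-! ### Indecomposability -/

theorem IsTrivial.finrank_eq {D : MultiFlag 𝕜 m} (h : D.IsTrivial) : Module.finrank 𝕜 D.V = 0 :=
  congrArg Prod.fst h

theorem isTrivial_of_finrank_eq {D : MultiFlag 𝕜 m} (h : Module.finrank 𝕜 D.V = 0) :
    D.IsTrivial := by
  refine Prod.ext h (funext fun i => ?_)
  have := Submodule.finrank_le (D.sub i)
  simp only [dim]
  omega

/-- Internal form of indecomposability. When each subspace lies wholly in one of two complementary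
subspaces, it is the direct sum of its intersections with them, so the splitting is a splitting of
flags. -/
theorem Indecomposable.eq_bot_or_eq_bot {D : MultiFlag 𝕜 m} (hD : D.Indecomposable)
    {P Q : Submodule 𝕜 D.V} (h : IsCompl P Q) (hsub : ∀ i, D.sub i ≤ P ∨ D.sub i ≤ Q) :
    P = ⊥ ∨ Q = ⊥ := by
  let D₁ : MultiFlag 𝕜 m := { V := P, sub := fun i => (D.sub i).comap P.subtype }
  let D₂ : MultiFlag 𝕜 m := { V := Q, sub := fun i => (D.sub i).comap Q.subtype }
  have hiso : (D₁.prod D₂).Iso D := by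
    refine ⟨P.prodEquivOfIsCompl Q h, fun i => le_antisymm ?_ ?_⟩
    · rintro _ ⟨⟨a, b⟩, ⟨ha, hb⟩, rfl⟩
      exact add_mem ha hb
    · intro v hv
      rcases hsub i with hP | hQ
      · exact ⟨(⟨v, hP hv⟩, 0), ⟨hv, zero_mem _⟩, add_zero v⟩
      · exact ⟨(0, ⟨v, hQ hv⟩), ⟨zero_mem _, hv⟩, zero_add v⟩
  rcases hD D₁ D₂ hiso.symm with h₁ | h₁
  · exact Or.inl (Submodule.finrank_eq_zero.1 h₁.finrank_eq)
  · exact Or.inr (Submodule.finrank_eq_zero.1 h₁.finrank_eq)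

/-- Converse of the internal criterion for flags of lines: a line compatible with a direct sum
cannot have two non-zero components, so it lies in one of the two summands. -/
theorem indecomposable_of_isCompl {D : MultiFlag 𝕜 m}
    (hdim : ∀ i, Module.finrank 𝕜 (D.sub i) ≤ 1)
    (h : ∀ P Q : Submodule 𝕜 D.V, IsCompl P Q → (∀ i, D.sub i ≤ P ∨ D.sub i ≤ Q) →
      P = ⊥ ∨ Q = ⊥) : D.Indecomposable := by
  rintro D₁ D₂ ⟨f, hf⟩
  let P : Submodule 𝕜 D.V := LinearMap.ker (LinearMap.snd 𝕜 D₁.V D₂.V ∘ₗ f.toLinearMap)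
  let Q : Submodule 𝕜 D.V := LinearMap.ker (LinearMap.fst 𝕜 D₁.V D₂.V ∘ₗ f.toLinearMap)
  have hP : ∀ v, v ∈ P ↔ (f v).2 = 0 := fun v => Iff.rfl
  have hQ : ∀ v, v ∈ Q ↔ (f v).1 = 0 := fun v => Iff.rfl
  have hPQ : IsCompl P Q := by
    constructor
    · rw [Submodule.disjoint_def]
      intro v h₁ h₂
      exact (map_eq_zero_iff f f.injective).1 (Prod.ext h₂ h₁)
    · rw [codisjoint_iff, eq_top_iff]
      intro v _
      refine Submodule.mem_sup.2 ⟨f.symm ((f v).1, 0), ?_, f.symm (0, (f v).2), ?_, ?_⟩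
      · simp [hP]
      · simp [hQ]
      · rw [← map_add]
        simp
  have hsub : ∀ i, D.sub i ≤ P ∨ D.sub i ≤ Q := by
    intro i
    obtain ⟨⟨v₀, hv₀⟩, hspan⟩ := finrank_le_one_iff.1 (hdim i)
    have hle : ∀ R : Submodule 𝕜 D.V, v₀ ∈ R → D.sub i ≤ R := by
      intro R hR v hv
      obtain ⟨c, hc⟩ := hspan ⟨v, hv⟩
      have hcv : c • v₀ = v := congrArg Subtype.val hc
      exact hcv ▸ R.smul_mem c hR
    have hmem : (f v₀).1 ∈ D₁.sub i ∧ (f v₀).2 ∈ D₂.sub i := (mem_sub_iff_of_map_eq (hf i) v₀).2 hv₀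
    have hmem' : f.symm ((f v₀).1, 0) ∈ D.sub i := by
      rw [← mem_sub_iff_of_map_eq (hf i)]
      simpa using hmem.1
    obtain ⟨c, hc⟩ := hspan ⟨_, hmem'⟩
    have hc' : c • f v₀ = ((f v₀).1, 0) := by
      rw [← map_smul, ← LinearEquiv.eq_symm_apply]
      exact congrArg Subtype.val hc
    -- The first component of the generator alone still lies in the line, so it is `c` times the
    -- generator. Either `c = 0` and the first component vanishes, or the second one does.
    rcases smul_eq_zero.1 (congrArg Prod.snd hc' : c • (f v₀).2 = 0) with h0 | h0
    · right
      refine hle Q ((hQ _).2 ?_)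
      rw [h0, zero_smul] at hc'
      exact (congrArg Prod.fst hc').symm
    · exact Or.inl (hle P ((hP _).2 h0))
  rcases h P Q hPQ hsub with h0 | h0
  · left
    apply isTrivial_of_finrank_eq
    rw [finrank_zero_iff_forall_zero]
    intro a
    have : f.symm (a, 0) ∈ P := by simp [hP]
    rw [h0, Submodule.mem_bot] at this
    simpa using this
  · right
    apply isTrivial_of_finrank_eq
    rw [finrank_zero_iff_forall_zero]
    intro a
    have : f.symm (0, a) ∈ Q := by simp [hQ]
    rw [h0, Submodule.mem_bot] at this
    simpa using this

/-- The subspaces of an indecomposable flag span it, unless they are all zero. -/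
theorem Indecomposable.iSup_sub_eq_top {D : MultiFlag 𝕜 m} (hD : D.Indecomposable) {i : Fin m}
    (hi : D.sub i ≠ ⊥) : ⨆ j, D.sub j = ⊤ := by
  obtain ⟨Q, hQ⟩ := Submodule.exists_isCompl (⨆ j, D.sub j)
  rcases hD.eq_bot_or_eq_bot hQ (fun j => Or.inl (le_iSup D.sub j)) with h | h
  · exact absurd (le_bot_iff.1 (h ▸ le_iSup D.sub i)) hi
  · rw [h] at hQ
    exact eq_top_of_isCompl_bot hQ

end MultiFlag

/-! ### Separators and blocks of a family of subspaces -/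

section Separator

variable {𝕜 V : Type*} [Field 𝕜] [AddCommGroup V] [Module 𝕜 V] {m : ℕ}

theorem Submodule.exists_linearMap_of_disjoint {A B : Submodule 𝕜 V} (h : Disjoint A B) :
    ∃ T : V →ₗ[𝕜] V, (∀ v ∈ A, T v = v) ∧ ∀ v ∈ B, T v = 0 := by
  obtain ⟨C, hBC, hAC⟩ := h.symm.exists_isCompl
  refine ⟨A.subtype ∘ₗ A.projectionOnto C hAC.symm, fun v hv => ?_, fun v hv => ?_⟩
  · exact congrArg Subtype.val (Submodule.projectionOnto_apply_left hAC.symm ⟨v, hv⟩)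
  · have : A.projectionOnto C hAC.symm v = 0 :=
      (Submodule.projectionOnto_apply_eq_zero_iff hAC.symm).2 (hBC hv)
    simp [this]

/-- A set `B` of indices separates a family of subspaces if some linear map is the identity on
the members in `B` and zero on the others. -/
def IsSeparator (ℓ : Fin m → Submodule 𝕜 V) (B : Finset (Fin m)) : Prop :=
  ∃ T : V →ₗ[𝕜] V, ∀ i, (i ∈ B → ∀ v ∈ ℓ i, T v = v) ∧ (i ∉ B → ∀ v ∈ ℓ i, T v = 0)

variable {ℓ : Fin m → Submodule 𝕜 V}

theorem IsSeparator.univ : IsSeparator ℓ Finset.univ :=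
  ⟨LinearMap.id, fun i => ⟨fun _ _ _ => rfl, fun h => absurd (Finset.mem_univ i) h⟩⟩

theorem IsSeparator.compl {B : Finset (Fin m)} (h : IsSeparator ℓ B) : IsSeparator ℓ Bᶜ := by
  obtain ⟨T, hT⟩ := h
  refine ⟨LinearMap.id - T, fun i => ⟨fun hi v hv => ?_, fun hi v hv => ?_⟩⟩
  · simp [(hT i).2 (Finset.mem_compl.1 hi) v hv]
  · simp [(hT i).1 (by simpa using hi) v hv]

/-- The two maps need not commute: `U` either fixes a line pointwise or kills it, so the composite
is determined on every line. -/
theorem IsSeparator.inter {B C : Finset (Fin m)} (hB : IsSeparator ℓ B) (hC : IsSeparator ℓ C) :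
    IsSeparator ℓ (B ∩ C) := by
  obtain ⟨T, hT⟩ := hB
  obtain ⟨U, hU⟩ := hC
  refine ⟨T ∘ₗ U, fun i => ⟨fun hi v hv => ?_, fun hi v hv => ?_⟩⟩
  · rw [Finset.mem_inter] at hi
    rw [LinearMap.comp_apply, (hU i).1 hi.2 v hv, (hT i).1 hi.1 v hv]
  · by_cases h : i ∈ C
    · have h' : i ∉ B := fun h' => hi (Finset.mem_inter.2 ⟨h', h⟩)
      rw [LinearMap.comp_apply, (hU i).1 h v hv, (hT i).2 h' v hv]
    · rw [LinearMap.comp_apply, (hU i).2 h v hv, map_zero]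

open Classical in
/-- The smallest separator containing `i`. -/
noncomputable def sepBlock (ℓ : Fin m → Submodule 𝕜 V) (i : Fin m) : Finset (Fin m) :=
  Finset.univ.filter fun j => ∀ B, IsSeparator ℓ B → i ∈ B → j ∈ B

theorem mem_sepBlock {i j : Fin m} :
    j ∈ sepBlock ℓ i ↔ ∀ B, IsSeparator ℓ B → i ∈ B → j ∈ B := by
  simp [sepBlock]

theorem self_mem_sepBlock (i : Fin m) : i ∈ sepBlock ℓ i := mem_sepBlock.2 fun _ _ h => h

theorem isSeparator_sepBlock (i : Fin m) : IsSeparator ℓ (sepBlock ℓ i) := by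
  classical
  have key : sepBlock ℓ i = (Finset.univ.filter fun B => IsSeparator ℓ B ∧ i ∈ B).inf id := by
    ext j
    simp [mem_sepBlock, Finset.mem_inf]
  rw [key]
  refine Finset.inf_induction IsSeparator.univ (fun B hB C hC => hB.inter hC) ?_
  intro B hB
  exact (Finset.mem_filter.1 hB).2.1

theorem sepBlock_subset {i : Fin m} {B : Finset (Fin m)} (hB : IsSeparator ℓ B) (hi : i ∈ B) :
    sepBlock ℓ i ⊆ B := fun _ hj => mem_sepBlock.1 hj B hB hi

/-- Closure under complement makes membership symmetric: if `i` were outside the block of `j`, the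
complement of that block would be a separator containing `i`, hence `j`. -/
theorem sepBlock_eq_of_mem {i j : Fin m} (h : j ∈ sepBlock ℓ i) :
    sepBlock ℓ j = sepBlock ℓ i := by
  refine (sepBlock_subset (isSeparator_sepBlock i) h).antisymm
    (sepBlock_subset (isSeparator_sepBlock j) ?_)
  by_contra hi
  have := mem_sepBlock.1 h _ (isSeparator_sepBlock j).compl (Finset.mem_compl.2 hi)
  exact Finset.mem_compl.1 this (self_mem_sepBlock j)

theorem eq_sepBlock_of_mem {s : Finset (Fin m)} (hs : ∃ i, sepBlock ℓ i = s) {j : Fin m}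
    (hj : j ∈ s) : s = sepBlock ℓ j := by
  obtain ⟨i, rfl⟩ := hs
  exact (sepBlock_eq_of_mem hj).symm

theorem finrank_sup_le_card [FiniteDimensional 𝕜 V]
    (hℓ : ∀ i, Module.finrank 𝕜 (ℓ i) ≤ 1) (s : Finset (Fin m)) :
    Module.finrank 𝕜 ↥(s.sup ℓ) ≤ s.card := by
  induction s using Finset.induction_on with
  | empty => simp
  | insert a s ha ih =>
    rw [Finset.sup_insert, Finset.card_insert_of_notMem ha]
    have h1 := Submodule.finrank_add_le_finrank_add_finrank (ℓ a) (s.sup ℓ)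
    have h2 := hℓ a
    omega

/-- A separator whose lines are independent splits into singletons. -/
theorem IsSeparator.singleton [FiniteDimensional 𝕜 V]
    (hℓ : ∀ i, Module.finrank 𝕜 (ℓ i) = 1) {s : Finset (Fin m)} (hs : IsSeparator ℓ s)
    (hcard : s.card ≤ Module.finrank 𝕜 ↥(s.sup ℓ)) {i : Fin m} (hi : i ∈ s) :
    IsSeparator ℓ {i} := by
  have hle := finrank_sup_le_card (fun i => (hℓ i).le) (s.erase i)
  rw [Finset.card_erase_of_mem hi] at hle
  have hsum := Submodule.finrank_sup_add_finrank_inf_eq (ℓ i) ((s.erase i).sup ℓ)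
  rw [← Finset.sup_insert, Finset.insert_erase hi, hℓ i] at hsum
  have hpos : 0 < s.card := Finset.card_pos.2 ⟨i, hi⟩
  -- The span of `s` has dimension at least `#s` and the lines other than `ℓ i` span at most `#s -
  -- 1`, so nothing is left for the intersection.
  have hinf : ℓ i ⊓ (s.erase i).sup ℓ = ⊥ := Submodule.finrank_eq_zero.1 (by omega)
  obtain ⟨T, hT₁, hT₂⟩ := Submodule.exists_linearMap_of_disjoint (disjoint_iff.2 hinf)
  obtain ⟨U, hU⟩ := hs
  refine ⟨T ∘ₗ U, fun j => ⟨fun hj v hv => ?_, fun hj v hv => ?_⟩⟩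
  · obtain rfl := Finset.mem_singleton.1 hj
    rw [LinearMap.comp_apply, (hU j).1 hi v hv, hT₁ v hv]
  · by_cases h : j ∈ s
    · rw [LinearMap.comp_apply, (hU j).1 h v hv]
      refine hT₂ v (Finset.le_sup (f := ℓ) (Finset.mem_erase.2 ⟨?_, h⟩) hv)
      simpa using hj
    · rw [LinearMap.comp_apply, (hU j).2 h v hv, map_zero]

theorem card_le_one_of_sepBlock [FiniteDimensional 𝕜 V]
    (hℓ : ∀ i, Module.finrank 𝕜 (ℓ i) = 1) {s : Finset (Fin m)} (hs : ∃ i, sepBlock ℓ i = s)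
    (hcard : s.card ≤ Module.finrank 𝕜 ↥(s.sup ℓ)) : s.card ≤ 1 := by
  obtain ⟨i, rfl⟩ := hs
  refine (Finset.card_le_card (sepBlock_subset
    ((isSeparator_sepBlock i).singleton hℓ hcard (self_mem_sepBlock i))
    (Finset.mem_singleton_self i))).trans ?_
  simp

theorem exists_linearMap_of_sepBlock {s : Finset (Fin m)} (hs : ∃ i, sepBlock ℓ i = s) :
    ∃ T : V →ₗ[𝕜] V, (∀ v ∈ s.sup ℓ, T v = v) ∧
      ∀ s', (∃ i, sepBlock ℓ i = s') → s' ≠ s → ∀ v ∈ s'.sup ℓ, T v = 0 := by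
  obtain ⟨T, hT⟩ : IsSeparator ℓ s := by
    obtain ⟨i, rfl⟩ := hs
    exact isSeparator_sepBlock i
  refine ⟨T, fun v hv => ?_, fun s' hs' hne v hv => ?_⟩
  · have : s.sup ℓ ≤ LinearMap.eqLocus T LinearMap.id := Finset.sup_le fun i hi w hw =>
      (hT i).1 hi w hw
    exact this hv
  · have : s'.sup ℓ ≤ LinearMap.ker T := Finset.sup_le fun i hi w hw => by
      refine (hT i).2 (fun his => hne ?_) w hw
      rw [eq_sepBlock_of_mem hs' hi, eq_sepBlock_of_mem hs his]
    exact this hv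

/-- The spans of distinct blocks are independent. -/
theorem sepBlock_sum_injective {β : Type*} [Fintype β] {blk : β → Finset (Fin m)}
    (hinj : Function.Injective blk) (hblk : ∀ b, ∃ i, sepBlock ℓ i = blk b)
    (w : ∀ b, ↥((blk b).sup ℓ)) (hw : ∑ b, (w b : V) = 0) : w = 0 := by
  funext b
  obtain ⟨T, hT₁, hT₂⟩ := exists_linearMap_of_sepBlock (hblk b)
  -- The separating map of block `b` extracts the `b`-th term of the relation.
  have h := congrArg T hw
  rw [map_zero, map_sum, Finset.sum_eq_single b] at h
  · rw [hT₁ _ (w b).2] at h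
    exact Subtype.ext h
  · intro b' _ hb'
    exact hT₂ _ (hblk b') (hinj.ne hb') _ (w b').2
  · simp

theorem sum_finrank_sepBlock_le [FiniteDimensional 𝕜 V] {β : Type*} [Fintype β]
    {blk : β → Finset (Fin m)} (hinj : Function.Injective blk)
    (hblk : ∀ b, ∃ i, sepBlock ℓ i = blk b) :
    ∑ b, Module.finrank 𝕜 ↥((blk b).sup ℓ) ≤ Module.finrank 𝕜 V := by
  classical
  rw [← Module.finrank_pi_fintype 𝕜]
  let Ψ : (∀ b, ↥((blk b).sup ℓ)) →ₗ[𝕜] V :=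
    ∑ b, ((blk b).sup ℓ).subtype ∘ₗ LinearMap.proj b
  have hΨ : ∀ w, Ψ w = ∑ b, (w b : V) := fun w => by simp [Ψ]
  refine LinearMap.finrank_le_finrank_of_injective (f := Ψ) ?_
  rw [injective_iff_map_eq_zero]
  intro w hw
  exact sepBlock_sum_injective hinj hblk w (by rw [← hΨ, hw])

end Separator

/-! ### Blocks of a type, and uniqueness of the type of a flag -/

namespace SplitType

variable {𝕜 : Type u} [Field 𝕜] {n m : ℕ}

/-- The blocks of `p`. -/
abbrev Block (p : SplitType n m) : Type := p.I ⊕ p.J ⊕ p.K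

noncomputable instance (p : SplitType n m) : DecidableEq p.Index := Classical.decEq _

/-- The underlying set of a block. -/
def blk (p : SplitType n m) : p.Block → Finset (Fin m)
  | .inl a => a.1
  | .inr (.inl b) => b.1
  | .inr (.inr c) => c.1.1

/-- The rank of a block. -/
def rk (p : SplitType n m) : p.Block → ℕ
  | .inl _ => 1
  | .inr (.inl b) => b.1.card - 1
  | .inr (.inr c) => c.1.2

theorem summandDim_inr (p : SplitType n m) (b : p.Block) :
    p.summandDim (.inr b) = MultiFlag.dimVec (p.blk b) (p.rk b) := by
  rcases b with a | b | c <;> rfl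

theorem existsUnique_block (p : SplitType n m) (i : Fin m) : ∃! b : p.Block, i ∈ p.blk b := by
  convert p.partition i using 2 with b
  rcases b with a | b | c <;> rfl

/-- The block of an index. -/
noncomputable def blockOf (p : SplitType n m) (i : Fin m) : p.Block :=
  (p.existsUnique_block i).choose

theorem mem_blk_iff (p : SplitType n m) {i : Fin m} {b : p.Block} :
    i ∈ p.blk b ↔ b = p.blockOf i := by
  have h := (p.existsUnique_block i).choose_spec
  exact ⟨fun hb => h.2 b hb, fun hb => hb ▸ h.1⟩

theorem mem_blk_blockOf (p : SplitType n m) (i : Fin m) : i ∈ p.blk (p.blockOf i) :=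
  p.mem_blk_iff.2 rfl

theorem card_blk_pos (p : SplitType n m) (b : p.Block) : 0 < (p.blk b).card := by
  rcases b with a | b | c
  · exact p.card_I _ a.2
  · exact lt_of_lt_of_le (by norm_num) (p.card_J _ b.2)
  · have := p.card_K _ c.2
    simp only [blk]
    omega

theorem sum_rk (p : SplitType n m) : ∑ b, p.rk b = p.rank := by
  rw [Fintype.sum_sum_type, Fintype.sum_sum_type]
  simp only [rk, rank, Finset.sum_const, Finset.card_univ, Fintype.card_coe, smul_eq_mul, mul_one]
  rw [Finset.sum_coe_sort p.J fun s => s.card - 1, Finset.sum_coe_sort p.K fun c => c.2, add_assoc]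

/-! ### Direct sums with summands of prescribed dimension -/

section DirectSum

variable {p : SplitType n m} {S : p.Index → MultiFlag 𝕜 m}

theorem finrank_V (hS : ∀ y, (S y).dim = p.summandDim y) (b : p.Block) :
    Module.finrank 𝕜 (S (.inr b)).V = p.rk b := by
  have := hS (.inr b)
  rw [summandDim_inr] at this
  exact congrArg Prod.fst this

theorem finrank_sub (hS : ∀ y, (S y).dim = p.summandDim y) (b : p.Block) (i : Fin m) :
    Module.finrank 𝕜 ((S (.inr b)).sub i) = if i ∈ p.blk b then 1 else 0 := by
  have := hS (.inr b)
  rw [summandDim_inr] at this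
  exact congrFun (congrArg Prod.snd this) i

theorem sub_eq_bot (hS : ∀ y, (S y).dim = p.summandDim y) {y : p.Index} {i : Fin m}
    (hy : y ≠ .inr (p.blockOf i)) : (S y).sub i = ⊥ := by
  apply Submodule.finrank_eq_zero.1
  rcases y with k | b
  · exact congrFun (congrArg Prod.snd (hS (.inl k))) i
  · rw [finrank_sub hS, if_neg]
    intro h
    exact hy (congrArg _ (p.mem_blk_iff.1 h))

theorem sub_ne_bot (hS : ∀ y, (S y).dim = p.summandDim y) {b : p.Block} {i : Fin m}
    (hi : i ∈ p.blk b) : (S (.inr b)).sub i ≠ ⊥ := by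
  intro h
  have := finrank_sub hS b i
  rw [h, if_pos hi, finrank_bot] at this
  omega

variable {F : MultiFlag 𝕜 m} {f : F.V ≃ₗ[𝕜] (MultiFlag.directSum S).V}

theorem apply_mem (hf : ∀ i, (F.sub i).map f.toLinearMap = (MultiFlag.directSum S).sub i)
    {i : Fin m} {v : F.V} (hv : v ∈ F.sub i) (y : p.Index) : f v y ∈ (S y).sub i :=
  (MultiFlag.mem_sub_iff_of_map_eq (hf i) v).2 hv y (Set.mem_univ y)

theorem apply_eq_zero (hS : ∀ y, (S y).dim = p.summandDim y)
    (hf : ∀ i, (F.sub i).map f.toLinearMap = (MultiFlag.directSum S).sub i)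
    {i : Fin m} {v : F.V} (hv : v ∈ F.sub i) {y : p.Index} (hy : y ≠ .inr (p.blockOf i)) :
    f v y = 0 := by
  have := apply_mem hf hv y
  rwa [sub_eq_bot hS hy, Submodule.mem_bot] at this

theorem symm_single_mem (hf : ∀ i, (F.sub i).map f.toLinearMap = (MultiFlag.directSum S).sub i)
    {i : Fin m} {y : p.Index} {u : (S y).V} (hu : u ∈ (S y).sub i) :
    f.symm (Pi.single y u) ∈ F.sub i := by
  rw [← MultiFlag.mem_sub_iff_of_map_eq (hf i), LinearEquiv.apply_symm_apply]
  intro z _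
  rcases eq_or_ne z y with rfl | h
  · simpa using hu
  · simp [Pi.single_eq_of_ne h]

theorem apply_eq_single (hS : ∀ y, (S y).dim = p.summandDim y)
    (hf : ∀ i, (F.sub i).map f.toLinearMap = (MultiFlag.directSum S).sub i)
    {i : Fin m} {v : F.V} (hv : v ∈ F.sub i) {y : p.Index} (hy : y = .inr (p.blockOf i)) :
    f.symm (Pi.single y (f v y)) = v := by
  rw [LinearEquiv.symm_apply_eq]
  funext z
  rcases eq_or_ne z y with rfl | h
  · simp
  · rw [Pi.single_eq_of_ne h, apply_eq_zero hS hf hv (hy ▸ h)]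

/-- The separating map is the projection onto the summand, transported by `f`: each line lives in
the summand of its own block only. -/
theorem isSeparator_blk (hS : ∀ y, (S y).dim = p.summandDim y)
    (hf : ∀ i, (F.sub i).map f.toLinearMap = (MultiFlag.directSum S).sub i) (b : p.Block) :
    IsSeparator F.sub (p.blk b) := by
  refine ⟨f.symm.toLinearMap ∘ₗ LinearMap.single 𝕜 (fun y => (S y).V) (.inr b) ∘ₗ
    LinearMap.proj (φ := fun y => (S y).V) (Sum.inr b) ∘ₗ f.toLinearMap, fun i => ⟨fun hi v hv => ?_, fun hi v hv => ?_⟩⟩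
  · exact apply_eq_single hS hf hv (congrArg _ (p.mem_blk_iff.1 hi))
  · have hne : (Sum.inr b : p.Index) ≠ .inr (p.blockOf i) := fun h =>
      hi (p.mem_blk_iff.2 (Sum.inr_injective h))
    have h0 : f v (.inr b) = 0 := apply_eq_zero hS hf hv hne
    change f.symm (Pi.single (.inr b) (f v (.inr b))) = 0
    rw [h0, Pi.single_zero, map_zero]

theorem iSup_sub_eq_top (hS : ∀ y, (S y).dim = p.summandDim y) {b : p.Block}
    (hind : (S (.inr b)).Indecomposable) : ⨆ i, (S (.inr b)).sub i = ⊤ := by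
  obtain ⟨i, hi⟩ := Finset.card_pos.1 (p.card_blk_pos b)
  exact hind.iSup_sub_eq_top (sub_ne_bot hS hi)

/-- A block is itself a separator, so it contains the minimal one. Conversely, a separator cutting
the block properly would, after compressing its map to the summand, split an indecomposable flag. -/
theorem blk_eq_sepBlock (hS : ∀ y, (S y).dim = p.summandDim y)
    (hf : ∀ i, (F.sub i).map f.toLinearMap = (MultiFlag.directSum S).sub i) {b : p.Block}
    (hind : (S (.inr b)).Indecomposable) {i : Fin m} (hi : i ∈ p.blk b) :
    p.blk b = sepBlock F.sub i := by
  refine Finset.Subset.antisymm ?_ (sepBlock_subset (isSeparator_blk hS hf b) hi)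
  intro j hj
  rw [mem_sepBlock]
  rintro B ⟨T, hT⟩ hiB
  let P := ⨆ j ∈ B, (S (.inr b)).sub j
  let Q := ⨆ j ∈ Bᶜ, (S (.inr b)).sub j
  -- Compression of `T` to the summand: it is the identity on `P` and zero on `Q`, which makes them
  -- disjoint.
  let U : (S (.inr b)).V →ₗ[𝕜] (S (.inr b)).V :=
    LinearMap.proj (φ := fun y => (S y).V) (Sum.inr b) ∘ₗ f.toLinearMap ∘ₗ T ∘ₗ f.symm.toLinearMap ∘ₗ
      LinearMap.single 𝕜 (fun y => (S y).V) (.inr b)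
  have hU : ∀ u, U u = f (T (f.symm (Pi.single (.inr b) u))) (.inr b) := fun _ => rfl
  have hP : P ≤ LinearMap.eqLocus U LinearMap.id := by
    refine iSup₂_le fun k hk u hu => ?_
    change U u = u
    rw [hU, (hT k).1 hk _ (symm_single_mem hf hu)]
    simp
  have hQ : Q ≤ LinearMap.ker U := by
    refine iSup₂_le fun k hk u hu => ?_
    rw [LinearMap.mem_ker, hU, (hT k).2 (Finset.mem_compl.1 hk) _ (symm_single_mem hf hu),
      map_zero]
    rfl
  have hmem : ∀ k, (S (.inr b)).sub k ≤ P ∨ (S (.inr b)).sub k ≤ Q := by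
    intro k
    by_cases hk : k ∈ B
    · exact Or.inl (le_iSup₂_of_le k hk le_rfl)
    · exact Or.inr (le_iSup₂_of_le k (Finset.mem_compl.2 hk) le_rfl)
  have hPQ : IsCompl P Q := by
    constructor
    · rw [Submodule.disjoint_def]
      intro u h₁ h₂
      exact (hP h₁ : U u = u).symm.trans (hQ h₂)
    · rw [codisjoint_iff, eq_top_iff, ← iSup_sub_eq_top hS hind]
      exact iSup_le fun k => (hmem k).elim le_sup_of_le_left le_sup_of_le_right
  rcases hind.eq_bot_or_eq_bot hPQ hmem with h | h
  · have : (S (.inr b)).sub i ≤ P := le_iSup₂_of_le i hiB le_rfl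
    exact absurd (le_bot_iff.1 (h ▸ this)) (sub_ne_bot hS hi)
  · by_contra hjB
    have : (S (.inr b)).sub j ≤ Q := le_iSup₂_of_le j (Finset.mem_compl.2 hjB) le_rfl
    exact absurd (le_bot_iff.1 (h ▸ this)) (sub_ne_bot hS hj)

/-- An indecomposable summand with a non-zero line is spanned by its lines, so its copy inside `F`
is exactly the span of the lines in the block. -/
theorem rk_eq_finrank (hS : ∀ y, (S y).dim = p.summandDim y)
    (hf : ∀ i, (F.sub i).map f.toLinearMap = (MultiFlag.directSum S).sub i) {b : p.Block}
    (hind : (S (.inr b)).Indecomposable) :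
    p.rk b = Module.finrank 𝕜 ↥((p.blk b).sup F.sub) := by
  let g : (S (.inr b)).V →ₗ[𝕜] F.V :=
    f.symm.toLinearMap ∘ₗ LinearMap.single 𝕜 (fun y => (S y).V) (.inr b)
  have hg : Function.Injective g :=
    f.symm.injective.comp (Pi.single_injective (M := fun y => (S y).V) (.inr b))
  rw [← finrank_V hS b, ← LinearMap.finrank_range_of_inj hg]
  suffices h : LinearMap.range g = (p.blk b).sup F.sub by rw [h]
  apply le_antisymm
  · rw [LinearMap.range_eq_map, ← iSup_sub_eq_top hS hind, Submodule.map_iSup]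
    refine iSup_le fun i => ?_
    by_cases hi : i ∈ p.blk b
    · refine le_trans ?_ (Finset.le_sup hi)
      rintro _ ⟨u, hu, rfl⟩
      exact symm_single_mem hf hu
    · rw [sub_eq_bot hS (fun h => hi (p.mem_blk_iff.2 (Sum.inr_injective h))), Submodule.map_bot]
      exact bot_le
  · refine Finset.sup_le fun i hi v hv => ?_
    exact ⟨f v (.inr b), apply_eq_single hS hf hv (congrArg _ (p.mem_blk_iff.1 hi))⟩

end DirectSum

theorem IsConstructible.blk_eq {p : SplitType n m} {F : MultiFlag 𝕜 m}
    (h : p.IsConstructible F) {b : p.Block} {i : Fin m} (hi : i ∈ p.blk b) :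
    p.blk b = sepBlock F.sub i := by
  obtain ⟨S, hS, f, hf⟩ := h
  exact blk_eq_sepBlock (fun y => (hS y).1) hf (hS _).2 hi

theorem IsConstructible.rk_eq {p : SplitType n m} {F : MultiFlag 𝕜 m}
    (h : p.IsConstructible F) (b : p.Block) :
    p.rk b = Module.finrank 𝕜 ↥((p.blk b).sup F.sub) := by
  obtain ⟨S, hS, f, hf⟩ := h
  exact rk_eq_finrank (fun y => (hS y).1) hf (hS _).2

/-- The family that contains a block is determined by the block and its rank. -/
theorem le_of_blocks {p p' : SplitType n m}
    (h : ∀ b : p.Block, ∃ b' : p'.Block, p.blk b = p'.blk b' ∧ p.rk b = p'.rk b') :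
    p.I ⊆ p'.I ∧ p.J ⊆ p'.J ∧ p.K ⊆ p'.K := by
  -- The pair (rank, cardinality) separates the families: rank 1 for `I`; rank at least 2 and
  -- cardinality rank + 1 for `J`; rank at least 2 and cardinality at least rank + 2 for `K`.
  refine ⟨fun s hs => ?_, fun s hs => ?_, fun c hc => ?_⟩
  · obtain ⟨b | b | b, h₁, h₂⟩ := h (.inl ⟨s, hs⟩) <;> simp only [blk, rk] at h₁ h₂
    · exact h₁ ▸ b.2
    · have := p'.card_J _ b.2
      omega
    · have := p'.card_K _ b.2
      omega
  · have h₀ := p.card_J _ hs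
    obtain ⟨b | b | b, h₁, h₂⟩ := h (.inr (.inl ⟨s, hs⟩)) <;> simp only [blk, rk] at h₁ h₂
    · omega
    · exact h₁ ▸ b.2
    · have := p'.card_K _ b.2
      rw [h₁] at h₂ h₀
      omega
  · have h₀ := p.card_K _ hc
    obtain ⟨b | b | b, h₁, h₂⟩ := h (.inr (.inr ⟨c, hc⟩)) <;> simp only [blk, rk] at h₁ h₂
    · omega
    · rw [h₁] at h₀
      omega
    · have : c = b.1 := Prod.ext h₁ h₂
      exact this ▸ b.2

theorem IsConstructible.exists_block {p p' : SplitType n m} {F : MultiFlag 𝕜 m}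
    (h : p.IsConstructible F) (h' : p'.IsConstructible F) (b : p.Block) :
    ∃ b' : p'.Block, p.blk b = p'.blk b' ∧ p.rk b = p'.rk b' := by
  obtain ⟨i, hi⟩ := Finset.card_pos.1 (p.card_blk_pos b)
  have heq : p.blk b = p'.blk (p'.blockOf i) := by
    rw [h.blk_eq hi, h'.blk_eq (p'.mem_blk_blockOf i)]
  exact ⟨_, heq, by rw [h.rk_eq, h'.rk_eq, heq]⟩

theorem IsConstructible.unique {p p' : SplitType n m} {F : MultiFlag 𝕜 m}
    (h : p.IsConstructible F) (h' : p'.IsConstructible F) : p = p' := by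
  obtain ⟨hI, hJ, hK⟩ := le_of_blocks (h.exists_block h')
  obtain ⟨hI', hJ', hK'⟩ := le_of_blocks (h'.exists_block h)
  cases p
  cases p'
  congr
  · exact hI.antisymm hI'
  · exact hJ.antisymm hJ'
  · exact hK.antisymm hK'

theorem IsConstructible.of_iso {p : SplitType n m} {F F' : MultiFlag 𝕜 m}
    (h : p.IsConstructible F) (hF : F'.Iso F) : p.IsConstructible F' := by
  obtain ⟨S, hS, hiso⟩ := h
  exact ⟨S, hS, hF.trans hiso⟩

end SplitType

/-! ### Existence of the type of a tuple of lines -/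

namespace SplitType

variable {𝕜 : Type u} [Field 𝕜] {n m : ℕ}

/-- Every family of `m` lines in an `n`-dimensional space has a type whose blocks are the minimal
separators. -/
theorem exists_sepBlocks {V : Type u} [AddCommGroup V] [Module 𝕜 V] [FiniteDimensional 𝕜 V]
    (hV : Module.finrank 𝕜 V = n) {ℓ : Fin m → Submodule 𝕜 V}
    (hℓ : ∀ i, Module.finrank 𝕜 (ℓ i) = 1) :
    ∃ p : SplitType n m, ∀ b, (∃ i, sepBlock ℓ i = p.blk b) ∧
      p.rk b = Module.finrank 𝕜 ↥((p.blk b).sup ℓ) := by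
  classical
  obtain ⟨ρ, hρ⟩ : ∃ ρ : Finset (Fin m) → ℕ, ∀ s, ρ s = Module.finrank 𝕜 ↥(s.sup ℓ) :=
    ⟨_, fun _ => rfl⟩
  have hρ_pos : ∀ s, (∃ i, sepBlock ℓ i = s) → 1 ≤ ρ s := by
    rintro _ ⟨i, rfl⟩
    rw [hρ, ← hℓ i]
    exact Submodule.finrank_mono (Finset.le_sup (self_mem_sepBlock i))
  have hρ_card : ∀ s, (∃ i, sepBlock ℓ i = s) → 2 ≤ ρ s → ρ s + 1 ≤ s.card := by
    intro s hs h2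
    by_contra hlt
    have hle := finrank_sup_le_card (fun i => (hℓ i).le) s
    rw [← hρ] at hle
    -- If the cardinality did not exceed the rank, the lines would be independent and the block a
    -- singleton, contradicting rank at least 2.
    have := card_le_one_of_sepBlock hℓ hs (by rw [← hρ]; omega)
    omega
  let B : Finset (Finset (Fin m)) := Finset.univ.image (sepBlock ℓ)
  let I := B.filter fun s => ρ s = 1
  let J := B.filter fun s => 2 ≤ ρ s ∧ s.card = ρ s + 1
  let K := (B.filter fun s => 2 ≤ ρ s ∧ ρ s + 2 ≤ s.card).image fun s => (s, ρ s)
  have hI : ∀ s ∈ I, (∃ i, sepBlock ℓ i = s) ∧ ρ s = 1 := fun s hs => by simpa [I, B] using hs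
  have hJ : ∀ s ∈ J, (∃ i, sepBlock ℓ i = s) ∧ 2 ≤ ρ s ∧ s.card = ρ s + 1 := fun s hs => by
    simpa [J, B] using hs
  have hK : ∀ c ∈ K, (∃ i, sepBlock ℓ i = c.1) ∧ 2 ≤ ρ c.1 ∧ ρ c.1 + 2 ≤ c.1.card ∧
      c.2 = ρ c.1 := by
    intro c hc
    obtain ⟨s, hs, rfl⟩ := Finset.mem_image.1 hc
    have := Finset.mem_filter.1 hs
    exact ⟨by simpa [B] using this.1, this.2.1, this.2.2, rfl⟩
  let blk : I ⊕ J ⊕ K → Finset (Fin m) :=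
    Sum.elim (fun a => a.1) (Sum.elim (fun b => b.1) (fun c => c.1.1))
  let rk : I ⊕ J ⊕ K → ℕ :=
    Sum.elim (fun _ => 1) (Sum.elim (fun b => b.1.card - 1) (fun c => c.1.2))
  have hblk : ∀ b, ∃ i, sepBlock ℓ i = blk b := by
    rintro (a | b | c)
    · exact (hI _ a.2).1
    · exact (hJ _ b.2).1
    · exact (hK _ c.2).1
  have hrk : ∀ b, rk b = ρ (blk b) := by
    rintro (a | b | c)
    · exact (hI _ a.2).2.symm
    · have := (hJ _ b.2).2.2
      simp only [rk, blk, Sum.elim_inl, Sum.elim_inr]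
      omega
    · exact (hK _ c.2).2.2.2
  have hinj : Function.Injective blk := by
    rintro (a | a | a) (b | b | b) hab <;> simp only [blk, Sum.elim_inl, Sum.elim_inr] at hab
    · rw [Subtype.ext hab]
    · have h₁ := hI _ a.2
      have h₂ := hJ _ b.2
      rw [hab] at h₁
      omega
    · have h₁ := hI _ a.2
      have h₂ := hK _ b.2
      rw [hab] at h₁
      omega
    · have h₁ := hJ _ a.2
      have h₂ := hI _ b.2
      rw [hab] at h₁
      omega
    · rw [Subtype.ext hab]
    · have h₁ := hJ _ a.2
      have h₂ := hK _ b.2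
      rw [hab] at h₁
      omega
    · have h₁ := hK _ a.2
      have h₂ := hI _ b.2
      rw [hab] at h₁
      omega
    · have h₁ := hK _ a.2
      have h₂ := hJ _ b.2
      rw [hab] at h₁
      omega
    · have h₁ := hK _ a.2
      have h₂ := hK _ b.2
      have : a.1 = b.1 := Prod.ext hab (by rw [h₁.2.2.2, h₂.2.2.2, hab])
      rw [Subtype.ext this]
  have hsurj : ∀ i, ∃ b, blk b = sepBlock ℓ i := by
    intro i
    have hB : sepBlock ℓ i ∈ B := Finset.mem_image_of_mem _ (Finset.mem_univ i)
    have h₁ := hρ_pos _ ⟨i, rfl⟩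
    have h₂ := hρ_card _ ⟨i, rfl⟩
    rcases h₁.eq_or_lt with h | h
    · exact ⟨.inl ⟨_, Finset.mem_filter.2 ⟨hB, h.symm⟩⟩, rfl⟩
    · rcases (h₂ h).eq_or_lt with h' | h'
      · exact ⟨.inr (.inl ⟨_, Finset.mem_filter.2 ⟨hB, h, h'.symm⟩⟩), rfl⟩
      · exact ⟨.inr (.inr ⟨_, Finset.mem_image_of_mem _ (Finset.mem_filter.2 ⟨hB, h, h'⟩)⟩), rfl⟩
  have hpart : ∀ i, ∃! b, i ∈ blk b := by
    intro i
    obtain ⟨b, hb⟩ := hsurj i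
    refine ⟨b, by simpa only [hb] using self_mem_sepBlock i, fun b' hb' => hinj ?_⟩
    rw [hb, eq_sepBlock_of_mem (hblk b') hb']
  have hsum : ∑ b, rk b ≤ n := by
    rw [← hV]
    refine le_trans (le_of_eq ?_) (sum_finrank_sepBlock_le hinj hblk)
    exact Finset.sum_congr rfl fun b _ => by rw [hrk, hρ]
  let p : SplitType n m :=
    { I := I
      J := J
      K := K
      partition := hpart
      card_I := fun s hs => by
        obtain ⟨i, rfl⟩ := (hI s hs).1
        exact Finset.card_pos.2 ⟨i, self_mem_sepBlock i⟩
      card_J := fun s hs => by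
        have := hJ s hs
        omega
      card_K := fun c hc => by
        have := hK c hc
        omega
      rank_le := by
        refine le_trans (le_of_eq ?_) hsum
        rw [Fintype.sum_sum_type, Fintype.sum_sum_type]
        simp only [rk, Sum.elim_inl, Sum.elim_inr, Finset.sum_const, Finset.card_univ,
          Fintype.card_coe, smul_eq_mul, mul_one]
        rw [Finset.sum_coe_sort J fun s => s.card - 1, Finset.sum_coe_sort K fun c => c.2,
          add_assoc] }
  refine ⟨p, fun b => ?_⟩
  have h₁ : p.blk b = blk b := by rcases b with a | b | c <;> rfl
  have h₂ : p.rk b = rk b := by rcases b with a | b | c <;> rfl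
  rw [h₁, h₂, ← hρ]
  exact ⟨hblk b, hrk b⟩

theorem blk_injective (p : SplitType n m) : Function.Injective p.blk := by
  intro b b' h
  obtain ⟨i, hi⟩ := Finset.card_pos.1 (p.card_blk_pos b)
  exact (p.mem_blk_iff.1 hi).trans (p.mem_blk_iff.1 (h ▸ hi)).symm

/-- The restriction of a flag to the span of the lines in a block. -/
abbrev blockFlag (F : MultiFlag 𝕜 m) (s : Finset (Fin m)) : MultiFlag 𝕜 m where
  V := ↥(s.sup F.sub)
  sub i := if i ∈ s then (F.sub i).comap (s.sup F.sub).subtype else ⊥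

/-- A splitting of the span of a block, composed with the separating map of the block, makes the
lines on one side a smaller separator. Minimality puts all lines on the same side. -/
theorem blockFlag_indecomposable {F : MultiFlag 𝕜 m} (hF : ∀ i, Module.finrank 𝕜 (F.sub i) = 1)
    {s : Finset (Fin m)} (hs : ∃ i, sepBlock F.sub i = s) : (blockFlag F s).Indecomposable := by
  classical
  have hsub : ∀ i ∈ s, (blockFlag F s).sub i = (F.sub i).comap (s.sup F.sub).subtype :=
    fun i hi => if_pos hi
  have hle : ∀ i ∈ s, F.sub i ≤ s.sup F.sub := fun i hi => Finset.le_sup hi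
  refine MultiFlag.indecomposable_of_isCompl (fun i => ?_) fun P Q hPQ hmem => ?_
  · by_cases hi : i ∈ s
    · rw [hsub i hi, (Submodule.comapSubtypeEquivOfLe (hle i hi)).finrank_eq, hF]
    · have : (blockFlag F s).sub i = ⊥ := if_neg hi
      rw [this, finrank_bot]
      exact zero_le_one
  · have htop : ∀ R : Submodule 𝕜 ↥(s.sup F.sub), (∀ i ∈ s, (blockFlag F s).sub i ≤ R) →
        R = ⊤ := by
      intro R hR
      have : s.sup F.sub ≤ R.map (s.sup F.sub).subtype := by
        refine Finset.sup_le fun i hi v hv => ?_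
        have hv' : (⟨v, hle i hi hv⟩ : ↥(s.sup F.sub)) ∈ (blockFlag F s).sub i := by
          rw [hsub i hi]
          exact hv
        exact ⟨_, hR i hi hv', rfl⟩
      rw [eq_top_iff]
      rintro ⟨v, hv⟩ -
      obtain ⟨w, hw, rfl⟩ := this hv
      exact hw
    by_cases hex : ∃ i ∈ s, (blockFlag F s).sub i ≤ P
    · right
      obtain ⟨i₀, hi₀, hi₀P⟩ := hex
      have hdisj : Disjoint (P.map (s.sup F.sub).subtype) (Q.map (s.sup F.sub).subtype) := by
        rw [disjoint_iff, ← Submodule.map_inf _ (Submodule.subtype_injective _),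
          hPQ.inf_eq_bot, Submodule.map_bot]
      obtain ⟨T, hT₁, hT₂⟩ := Submodule.exists_linearMap_of_disjoint hdisj
      obtain ⟨U, hU⟩ : IsSeparator F.sub s := by
        obtain ⟨i, rfl⟩ := hs
        exact isSeparator_sepBlock i
      have hsep : IsSeparator F.sub (s.filter fun i => (blockFlag F s).sub i ≤ P) := by
        refine ⟨T ∘ₗ U, fun i => ⟨fun hi v hv => ?_, fun hi v hv => ?_⟩⟩
        · obtain ⟨his, hiP⟩ := Finset.mem_filter.1 hi
          rw [LinearMap.comp_apply, (hU i).1 his v hv]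
          refine hT₁ v ⟨⟨v, hle i his hv⟩, hiP ?_, rfl⟩
          rw [hsub i his]
          exact hv
        · by_cases his : i ∈ s
          · rw [LinearMap.comp_apply, (hU i).1 his v hv]
            have hiQ := (hmem i).resolve_left fun h => hi (Finset.mem_filter.2 ⟨his, h⟩)
            refine hT₂ v ⟨⟨v, hle i his hv⟩, hiQ ?_, rfl⟩
            rw [hsub i his]
            exact hv
          · rw [LinearMap.comp_apply, (hU i).2 his v hv, map_zero]
      have hall := sepBlock_subset hsep (Finset.mem_filter.2 ⟨hi₀, hi₀P⟩)
      rw [← eq_sepBlock_of_mem hs hi₀] at hall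
      have hP := htop P fun i hi => (Finset.mem_filter.1 (hall hi)).2
      rw [hP] at hPQ
      exact eq_bot_of_top_isCompl hPQ
    · left
      push Not at hex
      have hQ := htop Q fun i hi => (hmem i).resolve_left (hex i hi)
      rw [hQ] at hPQ
      exact eq_bot_of_isCompl_top hPQ

theorem flagF_indecomposable (I : Finset (Fin m)) : (MultiFlag.flagF 𝕜 I).Indecomposable := by
  refine MultiFlag.indecomposable_of_isCompl (fun i => ?_) fun P Q hPQ _ => ?_
  · exact (Submodule.finrank_le _).trans (Module.finrank_self 𝕜).le
  · rcases eq_bot_or_eq_top (α := Ideal 𝕜) P with h | h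
    · exact Or.inl h
    · right
      have h' : P = ⊤ := h
      rw [h'] at hPQ
      exact eq_bot_of_top_isCompl hPQ

theorem flagF_dim (I : Finset (Fin m)) : (MultiFlag.flagF 𝕜 I).dim = MultiFlag.dimVec I 1 := by
  refine Prod.ext (Module.finrank_self 𝕜) (funext fun i => ?_)
  change Module.finrank 𝕜 (MultiFlag.subF 𝕜 I i) = if i ∈ I then 1 else 0
  by_cases hi : i ∈ I
  · rw [MultiFlag.subF, if_pos hi, if_pos hi, finrank_top, Module.finrank_self]
  · rw [MultiFlag.subF, if_neg hi, if_neg hi, finrank_bot]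

theorem sum_summandDim (p : SplitType n m) : ∑ y, (p.summandDim y).1 = n := by
  rw [Fintype.sum_sum_type]
  have h : ∑ b : p.Block, (p.summandDim (.inr b)).1 = p.rank := by
    refine Eq.trans ?_ p.sum_rk
    exact Finset.sum_congr rfl fun b _ => by rw [summandDim_inr]; rfl
  rw [h]
  simp only [summandDim, MultiFlag.dimVec, Finset.sum_const, Finset.card_univ, Fintype.card_fin,
    smul_eq_mul, mul_one]
  exact Nat.sub_add_cancel p.rank_le

theorem finrank_directSum {p : SplitType n m} {S : p.Index → MultiFlag 𝕜 m}
    (hS : ∀ y, (S y).dim = p.summandDim y) :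
    Module.finrank 𝕜 (MultiFlag.directSum S).V = n := by
  rw [Module.finrank_pi_fintype]
  refine Eq.trans ?_ p.sum_summandDim
  exact Finset.sum_congr rfl fun y _ => congrArg Prod.fst (hS y)

theorem eq_single_of_mem {p : SplitType n m} {S : p.Index → MultiFlag 𝕜 m}
    (hS : ∀ y, (S y).dim = p.summandDim y) {i : Fin m} {w : ∀ y, (S y).V}
    (hw : w ∈ (MultiFlag.directSum S).sub i) :
    w = Pi.single (M := fun y => (S y).V) (.inr (p.blockOf i)) (w (.inr (p.blockOf i))) := by
  funext y
  rcases eq_or_ne y (.inr (p.blockOf i)) with rfl | h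
  · rw [Pi.single_eq_same]
  · have hy : w y ∈ (S y).sub i := hw y (Set.mem_univ y)
    rw [sub_eq_bot hS h, Submodule.mem_bot] at hy
    rw [Pi.single_eq_of_ne h, hy]

theorem single_mem {p : SplitType n m} {S : p.Index → MultiFlag 𝕜 m} {i : Fin m} {y : p.Index}
    {u : (S y).V} (hu : u ∈ (S y).sub i) :
    Pi.single (M := fun y => (S y).V) y u ∈ (MultiFlag.directSum S).sub i := by
  intro z _
  rcases eq_or_ne z y with rfl | h
  · simpa using hu
  · simp [Pi.single_eq_of_ne h]

/-- Dimensions agree by the rank count of `p`, so independence of the images already gives an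
isomorphism of whole spaces. Line `i` needs checking only in its own block, since its other
components are zero. -/
theorem iso_directSum_of_independent {F : MultiFlag 𝕜 m} (hV : Module.finrank 𝕜 F.V = n)
    {p : SplitType n m} {S : p.Index → MultiFlag 𝕜 m} (hS : ∀ y, (S y).dim = p.summandDim y)
    (g : ∀ y, (S y).V →ₗ[𝕜] F.V) (hg : ∀ w : ∀ y, (S y).V, ∑ y, g y (w y) = 0 → w = 0)
    (hsub : ∀ i, ((S (.inr (p.blockOf i))).sub i).map (g (.inr (p.blockOf i))) = F.sub i) :
    F.Iso (MultiFlag.directSum S) := by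
  let Ψ : (∀ y, (S y).V) →ₗ[𝕜] F.V := ∑ y, g y ∘ₗ LinearMap.proj y
  have hΨ : ∀ w, Ψ w = ∑ y, g y (w y) := fun w => by simp [Ψ]
  have hΨ_inj : Function.Injective Ψ := by
    rw [injective_iff_map_eq_zero]
    exact fun w hw => hg w (by rw [← hΨ, hw])
  have hΨ_single : ∀ y (u : (S y).V), Ψ (Pi.single (M := fun y => (S y).V) y u) = g y u := by
    intro y u
    rw [hΨ, Finset.sum_eq_single y]
    · rw [Pi.single_eq_same]
    · intro z _ hz
      rw [Pi.single_eq_of_ne hz, map_zero]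
    · simp
  let e : (∀ y, (S y).V) ≃ₗ[𝕜] F.V :=
    LinearEquiv.ofInjectiveOfFinrankEq Ψ hΨ_inj ((finrank_directSum hS).trans hV.symm)
  refine MultiFlag.Iso.symm ⟨e, fun i => ?_⟩
  rw [← hsub i]
  apply le_antisymm
  · rintro _ ⟨w, hw, rfl⟩
    refine ⟨w (.inr (p.blockOf i)), hw _ (Set.mem_univ _), ?_⟩
    rw [← hΨ_single, ← eq_single_of_mem hS hw]
    rfl
  · rintro _ ⟨u, hu, rfl⟩
    exact ⟨_, single_mem hu, hΨ_single _ _⟩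

/-- A tuple of lines in an `n`-dimensional space is constructible for the type of its blocks. -/
theorem isConstructible_of_sepBlocks {F : MultiFlag 𝕜 m} (hV : Module.finrank 𝕜 F.V = n)
    (hF : ∀ i, Module.finrank 𝕜 (F.sub i) = 1) {p : SplitType n m}
    (hp : ∀ b, (∃ i, sepBlock F.sub i = p.blk b) ∧
      p.rk b = Module.finrank 𝕜 ↥((p.blk b).sup F.sub)) : p.IsConstructible F := by
  let S : p.Index → MultiFlag 𝕜 m :=
    Sum.elim (fun _ => MultiFlag.flagF 𝕜 ∅) (fun b => blockFlag F (p.blk b))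
  have hS : ∀ y, (S y).dim = p.summandDim y := by
    rintro (k | b)
    · exact flagF_dim ∅
    · rw [summandDim_inr]
      refine Prod.ext (hp b).2.symm (funext fun i => ?_)
      change Module.finrank 𝕜 ((blockFlag F (p.blk b)).sub i) = if i ∈ p.blk b then 1 else 0
      by_cases hi : i ∈ p.blk b
      · have hle : F.sub i ≤ (p.blk b).sup F.sub := Finset.le_sup hi
        have : (blockFlag F (p.blk b)).sub i = (F.sub i).comap ((p.blk b).sup F.sub).subtype :=
          if_pos hi
        rw [if_pos hi, this, (Submodule.comapSubtypeEquivOfLe hle).finrank_eq, hF]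
      · have : (blockFlag F (p.blk b)).sub i = ⊥ := if_neg hi
        rw [if_neg hi, this, finrank_bot]
  refine ⟨S, fun y => ⟨hS y, ?_⟩, ?_⟩
  · rcases y with k | b
    · exact flagF_indecomposable ∅
    · exact blockFlag_indecomposable hF (hp b).1
  · let Φ : (∀ b, ↥((p.blk b).sup F.sub)) →ₗ[𝕜] F.V :=
      ∑ b, ((p.blk b).sup F.sub).subtype ∘ₗ LinearMap.proj b
    have hΦ : ∀ w, Φ w = ∑ b, (w b : F.V) := fun w => by simp [Φ]
    have hΦ_inj : Function.Injective Φ := by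
      rw [injective_iff_map_eq_zero]
      intro w hw
      exact sepBlock_sum_injective p.blk_injective (fun b => (hp b).1) w (by rw [← hΦ, hw])
    have hrange : Module.finrank 𝕜 (LinearMap.range Φ) = p.rank := by
      rw [LinearMap.finrank_range_of_inj hΦ_inj, Module.finrank_pi_fintype, ← p.sum_rk]
      exact Finset.sum_congr rfl fun b _ => (hp b).2.symm
    -- A complement of the span of all lines supplies the `n - r(p)` summands `F(∅)`, one for each
    -- vector of a basis.
    obtain ⟨Z, hZ⟩ := Submodule.exists_isCompl (LinearMap.range Φ)
    have hZrank : Module.finrank 𝕜 Z = n - p.rank := by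
      have := Submodule.finrank_add_eq_of_isCompl hZ
      omega
    let u : Module.Basis (Fin (n - p.rank)) 𝕜 Z := Module.finBasisOfFinrankEq 𝕜 Z hZrank
    let g : ∀ y, (S y).V →ₗ[𝕜] F.V
      | .inl k => LinearMap.toSpanSingleton 𝕜 F.V (u k)
      | .inr b => ((p.blk b).sup F.sub).subtype
    refine iso_directSum_of_independent hV hS g (fun w hw => ?_) fun i => ?_
    · rw [Fintype.sum_sum_type] at hw
      obtain ⟨c, hc⟩ : ∃ c : Fin (n - p.rank) → 𝕜, ∀ k, c k = w (.inl k) := ⟨_, fun _ => rfl⟩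
      obtain ⟨v, hv⟩ : ∃ v : ∀ b, ↥((p.blk b).sup F.sub), ∀ b, v b = w (.inr b) :=
        ⟨_, fun _ => rfl⟩
      have hw' : ((∑ k, c k • u k : Z) : F.V) + Φ v = 0 := by
        rw [hΦ, Submodule.coe_sum, ← hw]
        congr 1
        · exact Finset.sum_congr rfl fun k _ => by rw [hc]; rfl
        · exact Finset.sum_congr rfl fun b _ => by rw [hv]; rfl
      have h₀ : ((∑ k, c k • u k : Z) : F.V) = 0 := by
        refine (Submodule.disjoint_def.1 hZ.disjoint) _ ?_ (Subtype.prop _)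
        rw [eq_neg_of_add_eq_zero_left hw']
        exact neg_mem ⟨_, rfl⟩
      have h₁ : ∀ k, c k = 0 :=
        Fintype.linearIndependent_iff.1 u.linearIndependent c (Subtype.ext h₀)
      have h₂ : v = 0 := by
        apply hΦ_inj
        rw [h₀, zero_add] at hw'
        rw [hw', map_zero]
      funext y
      rcases y with k | b
      · rw [← hc, h₁]
        rfl
      · rw [← hv, h₂]
        rfl
    · have hle : F.sub i ≤ (p.blk (p.blockOf i)).sup F.sub := Finset.le_sup (p.mem_blk_blockOf i)
      have hsub : (S (.inr (p.blockOf i))).sub i =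
          (F.sub i).comap ((p.blk (p.blockOf i)).sup F.sub).subtype := if_pos (p.mem_blk_blockOf i)
      rw [hsub]
      exact (Submodule.map_comap_subtype _ _).trans (inf_eq_right.2 hle)

theorem existsUnique_isConstructible {F : MultiFlag 𝕜 m} (hV : Module.finrank 𝕜 F.V = n)
    (hF : ∀ i, Module.finrank 𝕜 (F.sub i) = 1) : ∃! p : SplitType n m, p.IsConstructible F := by
  obtain ⟨p, hp⟩ := exists_sepBlocks hV hF
  have h := isConstructible_of_sepBlocks hV hF hp
  exact ⟨p, h, fun p' hp' => hp'.unique h⟩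

end SplitType

/-! ### Normal forms of the indecomposable summands -/

namespace MultiFlag

variable {𝕜 : Type u} [Field 𝕜] {m : ℕ}

/-! ### The increasing enumeration of a set of indices -/

/-- The increasing enumeration of `K`. -/
def enum (K : Finset (Fin m)) (h : Fin K.card) : Fin m := K.orderIsoOfFin rfl h

theorem enum_mem (K : Finset (Fin m)) (h : Fin K.card) : enum K h ∈ K :=
  (K.orderIsoOfFin rfl h).2

theorem position_enum (K : Finset (Fin m)) (h : Fin K.card) :
    position K (enum K h) (enum_mem K h) = h :=
  (K.orderIsoOfFin rfl).symm_apply_apply h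

theorem exists_enum_eq {K : Finset (Fin m)} {i : Fin m} (hi : i ∈ K) : ∃ h, enum K h = i :=
  ⟨position K i hi, congrArg Subtype.val ((K.orderIsoOfFin rfl).apply_symm_apply ⟨i, hi⟩)⟩

section SubE

variable {K : Finset (Fin m)} {r : ℕ} (q : Fin (K.card - r - 1) → ℙ 𝕜 (Fin r → 𝕜))

theorem subE_of_lt (h : Fin r) (h' : (h : ℕ) < K.card) :
    subE K r q (enum K ⟨h, h'⟩) = 𝕜 ∙ (Pi.single h (1 : 𝕜) : Fin r → 𝕜) := by
  have hp : (position K (enum K ⟨h, h'⟩) (enum_mem K _) : ℕ) = h :=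
    congrArg Fin.val (position_enum K _)
  rw [subE, dif_pos (enum_mem K _), dif_pos (by omega)]
  congr 3
  exact Fin.ext hp

theorem subE_of_eq (h : r < K.card) :
    subE K r q (enum K ⟨r, h⟩) = 𝕜 ∙ (fun _ => 1 : Fin r → 𝕜) := by
  have hp : (position K (enum K ⟨r, h⟩) (enum_mem K _) : ℕ) = r :=
    congrArg Fin.val (position_enum K _)
  rw [subE, dif_pos (enum_mem K _), dif_neg (by omega), dif_pos hp]

theorem subE_of_gt (j : Fin (K.card - r - 1)) (h : r + 1 + j < K.card) :
    subE K r q (enum K ⟨r + 1 + j, h⟩) = (q j).submodule := by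
  have hp : (position K (enum K ⟨r + 1 + j, h⟩) (enum_mem K _) : ℕ) = r + 1 + j :=
    congrArg Fin.val (position_enum K _)
  rw [subE, dif_pos (enum_mem K _), dif_neg (by omega), dif_neg (by omega)]
  congr 2
  apply Fin.ext
  simp only [hp]
  omega

theorem subE_of_notMem {i : Fin m} (hi : i ∉ K) : subE K r q i = ⊥ := dif_neg hi

/-- The members of `K` are the frame indices and the parameter indices. -/
theorem enum_cases {C : Fin m → Prop} (hrK : r < K.card)
    (h₁ : ∀ (h : Fin r) (h' : (h : ℕ) < K.card), C (enum K ⟨h, h'⟩)) (h₂ : C (enum K ⟨r, hrK⟩))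
    (h₃ : ∀ (j : Fin (K.card - r - 1)) (h : r + 1 + j < K.card), C (enum K ⟨r + 1 + j, h⟩))
    {i : Fin m} (hi : i ∈ K) : C i := by
  obtain ⟨⟨h, hK⟩, rfl⟩ := exists_enum_eq hi
  rcases lt_trichotomy h r with hlt | rfl | hgt
  · exact h₁ ⟨h, hlt⟩ hK
  · exact h₂
  · have := h₃ ⟨h - r - 1, by omega⟩ (by simp only; omega)
    convert this using 3
    simp only
    omega

end SubE

/-- A flag whose lines contain a projective frame is isomorphic to one of the flags
`E(K, r, q)`. -/
theorem iso_flagE {D : MultiFlag 𝕜 m} {K : Finset (Fin m)} {r : ℕ} (hrK : r < K.card)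
    {w : Fin m → D.V} (hw : ∀ i ∈ K, D.sub i = 𝕜 ∙ w i) (hw₀ : ∀ i ∉ K, D.sub i = ⊥)
    (β : Module.Basis (Fin r) 𝕜 D.V) (hβ : ∀ h : Fin r, w (enum K ⟨h, h.2.trans hrK⟩) = β h)
    (hc : ∀ h, β.repr (w (enum K ⟨r, hrK⟩)) h ≠ 0)
    {q : Fin (K.card - r - 1) → ℙ 𝕜 (Fin r → 𝕜)}
    (hq : ∀ (j : Fin (K.card - r - 1)) (h : r + 1 + j < K.card), (q j).submodule =
      𝕜 ∙ (fun k => β.repr (w (enum K ⟨r + 1 + j, h⟩)) k / β.repr (w (enum K ⟨r, hrK⟩)) k)) :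
    D.Iso (flagE K r q) := by
  -- Coordinates in `β`, rescaled so that the vector at position `r` becomes `(1, …, 1)`; the axes
  -- are preserved by the rescaling.
  let g : D.V ≃ₗ[𝕜] (Fin r → 𝕜) := β.equivFun.trans
    (LinearEquiv.piCongrRight fun h => LinearEquiv.smulOfUnit (Units.mk0 _ (hc h))⁻¹)
  have hg : ∀ v h, g v h = β.repr v h / β.repr (w (enum K ⟨r, hrK⟩)) h := by
    intro v h
    rw [div_eq_inv_mul]
    rfl
  refine ⟨g, fun i => ?_⟩
  by_cases hi : i ∈ K
  · have key : 𝕜 ∙ g (w i) = subE K r q i := by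
      refine enum_cases (C := fun i => 𝕜 ∙ g (w i) = subE K r q i) hrK ?_ ?_ ?_ hi
      · intro h h'
        rw [subE_of_lt, hβ]
        have : g (β h) = (β.repr (w (enum K ⟨r, hrK⟩)) h)⁻¹ • Pi.single h (1 : 𝕜) := by
          funext k
          rw [hg, Module.Basis.repr_self, Pi.smul_apply]
          rcases eq_or_ne k h with rfl | hk
          · simp
          · simp [hk, Finsupp.single_eq_of_ne hk]
        rw [this]
        exact Submodule.span_singleton_smul_eq (IsUnit.mk0 _ (inv_ne_zero (hc h))) _
      · rw [subE_of_eq]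
        congr 2
        funext h
        rw [hg, div_self (hc h)]
      · intro j h
        rw [subE_of_gt, hq j h]
        congr 2
        funext k
        rw [hg]
    rw [hw i hi, Submodule.map_span, Set.image_singleton]
    exact key
  · rw [hw₀ i hi, Submodule.map_bot]
    exact (subE_of_notMem q hi).symm

theorem flagE_finrank_sub {K : Finset (Fin m)} {r : ℕ} (hr : 0 < r) (hrK : r < K.card)
    (q : Fin (K.card - r - 1) → ℙ 𝕜 (Fin r → 𝕜)) {i : Fin m} (hi : i ∈ K) :
    Module.finrank 𝕜 (subE K r q i) = 1 := by
  refine enum_cases (C := fun i => Module.finrank 𝕜 (subE K r q i) = 1) hrK ?_ ?_ ?_ hi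
  · intro h h'
    rw [subE_of_lt]
    exact finrank_span_singleton (by simp)
  · rw [subE_of_eq]
    exact finrank_span_singleton fun h => one_ne_zero (congrFun h ⟨0, hr⟩)
  · intro j h
    rw [subE_of_gt]
    exact Projectivization.finrank_submodule _

theorem flagE_dim {K : Finset (Fin m)} {r : ℕ} (hr : 0 < r) (hrK : r < K.card)
    (q : Fin (K.card - r - 1) → ℙ 𝕜 (Fin r → 𝕜)) : (flagE K r q).dim = dimVec K r := by
  refine Prod.ext (Module.finrank_fin_fun 𝕜) (funext fun i => ?_)
  change Module.finrank 𝕜 (subE K r q i) = if i ∈ K then 1 else 0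
  by_cases hi : i ∈ K
  · rw [if_pos hi, flagE_finrank_sub hr hrK q hi]
  · rw [if_neg hi, subE_of_notMem q hi, finrank_bot]

/-- The frame alone forces indecomposability; the lines of `q` play no role. Each axis lies in one
part of a splitting, and the part containing `(1, …, 1)` has to contain every axis. -/
theorem flagE_indecomposable {K : Finset (Fin m)} {r : ℕ} (hr : 0 < r) (hrK : r < K.card)
    (q : Fin (K.card - r - 1) → ℙ 𝕜 (Fin r → 𝕜)) : (flagE K r q).Indecomposable := by
  refine indecomposable_of_isCompl (fun i => ?_) fun P Q hPQ hmem => ?_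
  · have := congrFun (congrArg Prod.snd (flagE_dim hr hrK q)) i
    simp only [dim, dimVec] at this
    rw [this]
    split_ifs <;> omega
  · have hsingle : ∀ h : Fin r, (Pi.single h 1 : Fin r → 𝕜) ∈ P ∨ (Pi.single h 1 : Fin r → 𝕜) ∈ Q := by
      intro h
      have := hmem (enum K ⟨h, h.2.trans hrK⟩)
      change subE K r q _ ≤ P ∨ subE K r q _ ≤ Q at this
      rwa [subE_of_lt, Submodule.span_singleton_le_iff_mem, Submodule.span_singleton_le_iff_mem]
        at this
    have main : ∀ P Q : Submodule 𝕜 (Fin r → 𝕜), Disjoint P Q → (fun _ => 1 : Fin r → 𝕜) ∈ P →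
        (∀ h : Fin r, (Pi.single h 1 : Fin r → 𝕜) ∈ P ∨ (Pi.single h 1 : Fin r → 𝕜) ∈ Q) →
        P = ⊤ := by
      classical
      intro P Q hdisj hone hs
      let A := Finset.univ.filter fun h : Fin r => (Pi.single h 1 : Fin r → 𝕜) ∈ P
      have hA : ∑ h ∈ A, (Pi.single h 1 : Fin r → 𝕜) ∈ P :=
        sum_mem fun h hh => (Finset.mem_filter.1 hh).2
      have hAc : ∑ h ∈ Aᶜ, (Pi.single h 1 : Fin r → 𝕜) ∈ Q := by
        refine sum_mem fun h hh => (hs h).resolve_left fun hP => ?_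
        exact Finset.mem_compl.1 hh (Finset.mem_filter.2 ⟨Finset.mem_univ h, hP⟩)
      have hsum : ∑ h ∈ A, (Pi.single h 1 : Fin r → 𝕜) + ∑ h ∈ Aᶜ, (Pi.single h 1 : Fin r → 𝕜) =
          fun _ => 1 := by
        rw [Finset.sum_add_sum_compl]
        exact Finset.univ_sum_single (fun _ => (1 : 𝕜))
      -- This partial sum lies in `Q`, and also in `P` as the difference of `(1, …, 1)` and the sum
      -- of the axis vectors in `P`.
      have hzero : ∑ h ∈ Aᶜ, (Pi.single h 1 : Fin r → 𝕜) = 0 := by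
        refine Submodule.disjoint_def.1 hdisj _ ?_ hAc
        rw [eq_sub_of_add_eq' hsum]
        exact sub_mem hone hA
      have hall : ∀ h : Fin r, (Pi.single h 1 : Fin r → 𝕜) ∈ P := by
        intro h
        by_contra hP
        have hh : h ∈ Aᶜ := Finset.mem_compl.2 fun hh => hP (Finset.mem_filter.1 hh).2
        have := congrFun hzero h
        rw [Finset.sum_apply, Finset.sum_pi_single, if_pos hh] at this
        exact one_ne_zero this
      rw [eq_top_iff]
      intro v _
      rw [← Finset.univ_sum_single v]
      refine sum_mem fun h _ => ?_
      have : (Pi.single h (v h) : Fin r → 𝕜) = v h • Pi.single h 1 := by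
        rw [← Pi.single_smul, smul_eq_mul, mul_one]
      rw [this]
      exact P.smul_mem _ (hall h)
    have hone := hmem (enum K ⟨r, hrK⟩)
    change subE K r q _ ≤ P ∨ subE K r q _ ≤ Q at hone
    rw [subE_of_eq, Submodule.span_singleton_le_iff_mem, Submodule.span_singleton_le_iff_mem]
      at hone
    rcases hone with h | h
    · right
      have hP := main P Q hPQ.disjoint h hsingle
      rw [hP] at hPQ
      exact eq_bot_of_top_isCompl hPQ
    · left
      have hQ := main Q P hPQ.disjoint.symm h fun k => (hsingle k).symm
      rw [hQ] at hPQ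
      exact eq_bot_of_isCompl_top hPQ

/-- For `r = #J - 1` the frame uses up all of `J` and no parameters remain, so the statements about
`E` cover `D` as well. -/
theorem flagD_eq_flagE (J : Finset (Fin m)) (hJ : 0 < J.card)
    (q : Fin (J.card - (J.card - 1) - 1) → ℙ 𝕜 (Fin (J.card - 1) → 𝕜)) :
    flagD 𝕜 J = flagE J (J.card - 1) q := by
  have : subD 𝕜 J = subE J (J.card - 1) q := by
    funext i
    by_cases hi : i ∈ J
    · rw [subD, subE, dif_pos hi, dif_pos hi]
      by_cases h : (position J i hi : ℕ) < J.card - 1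
      · rw [dif_pos h, dif_pos h]
      · have := (position J i hi).2
        rw [dif_neg h, dif_neg h, dif_pos (by omega)]
    · rw [subD, subE, dif_neg hi, dif_neg hi]
  rw [flagD, flagE, this]

theorem exists_span_singleton {V : Type*} [AddCommGroup V] [Module 𝕜 V] {W : Submodule 𝕜 V}
    [FiniteDimensional 𝕜 V] (hW : Module.finrank 𝕜 W ≤ 1) : ∃ w, W = 𝕜 ∙ w := by
  obtain ⟨⟨w, hw⟩, h⟩ := finrank_le_one_iff.1 hW
  refine ⟨w, le_antisymm (fun v hv => ?_) ((Submodule.span_singleton_le_iff_mem w W).2 hw)⟩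
  obtain ⟨c, hc⟩ := h ⟨v, hv⟩
  exact Submodule.mem_span_singleton.2 ⟨c, congrArg Subtype.val hc⟩

/-- In an indecomposable flag with one line more than the dimension, every nontrivial linear
relation between the lines has full support. -/
theorem Indecomposable.ne_zero_of_relation {D : MultiFlag 𝕜 m} (hD : D.Indecomposable) {r : ℕ}
    (hr : Module.finrank 𝕜 D.V = r) {v : Fin (r + 1) → D.V} (hv : ∀ h, v h ≠ 0)
    (hsub : ∀ i, ∃ h, D.sub i ≤ 𝕜 ∙ v h) (htop : ⨆ i, D.sub i = ⊤) {c : Fin (r + 1) → 𝕜}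
    (hc : ∑ h, c h • v h = 0) {h₀ : Fin (r + 1)} (hh₀ : c h₀ ≠ 0) (h₁ : Fin (r + 1)) :
    c h₁ ≠ 0 := by
  classical
  intro hh₁
  let ℓ : Fin (r + 1) → Submodule 𝕜 D.V := fun h => 𝕜 ∙ v h
  have hℓ : ∀ h, Module.finrank 𝕜 (ℓ h) ≤ 1 := fun h => (finrank_span_singleton (hv h)).le
  let Z := Finset.univ.filter fun h => c h ≠ 0
  have hZ : ∀ h, h ∈ Z ↔ c h ≠ 0 := fun h => by simp [Z]
  have hZ₀ : h₀ ∈ Z := (hZ _).2 hh₀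
  have hZ₁ : h₁ ∈ Zᶜ := by simp [hZ, hh₁]
  have hmem : v h₀ ∈ (Z.erase h₀).sup ℓ := by
    have hsum : c h₀ • v h₀ = -∑ h ∈ Z.erase h₀, c h • v h := by
      rw [eq_neg_iff_add_eq_zero, Finset.add_sum_erase Z (fun h => c h • v h) hZ₀, ← hc]
      refine Finset.sum_subset (Finset.subset_univ _) fun h _ hh => ?_
      rw [hZ, not_not] at hh
      rw [hh, zero_smul]
    have : c h₀ • v h₀ ∈ (Z.erase h₀).sup ℓ := by
      rw [hsum]
      refine neg_mem (sum_mem fun h hh => Submodule.smul_mem _ _ ?_)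
      exact Finset.le_sup (f := ℓ) hh (Submodule.mem_span_singleton_self (v h))
    rwa [Submodule.smul_mem_iff _ hh₀] at this
  have hle : Z.sup ℓ ≤ (Z.erase h₀).sup ℓ := by
    refine Finset.sup_le fun h hh => ?_
    rcases eq_or_ne h h₀ with rfl | hne
    · exact (Submodule.span_singleton_le_iff_mem _ _).2 hmem
    · exact Finset.le_sup (Finset.mem_erase.2 ⟨hne, hh⟩)
  -- Inside the support of the relation one vector is redundant, so the support spans at most `#Z -
  -- 1` dimensions. The complement spans at most `#Zᶜ`, and the two bounds add up to `r`, the whole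
  -- dimension; hence the sum is direct.
  have hrZ := (Submodule.finrank_mono hle).trans (finrank_sup_le_card hℓ _)
  have hrZc := finrank_sup_le_card hℓ Zᶜ
  rw [Finset.card_erase_of_mem hZ₀] at hrZ
  have hposZ : 0 < Z.card := Finset.card_pos.2 ⟨_, hZ₀⟩
  have hcard := Finset.card_add_card_compl Z
  rw [Fintype.card_fin] at hcard
  have hmem' : ∀ i, D.sub i ≤ Z.sup ℓ ∨ D.sub i ≤ Zᶜ.sup ℓ := by
    intro i
    obtain ⟨h, hh⟩ := hsub i
    by_cases hz : h ∈ Z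
    · exact Or.inl (hh.trans (Finset.le_sup (f := ℓ) hz))
    · exact Or.inr (hh.trans (Finset.le_sup (f := ℓ) (Finset.mem_compl.2 hz)))
  have hsup : Z.sup ℓ ⊔ Zᶜ.sup ℓ = ⊤ := by
    rw [eq_top_iff, ← htop]
    exact iSup_le fun i => (hmem' i).elim le_sup_of_le_left le_sup_of_le_right
  have hdim := Submodule.finrank_sup_add_finrank_inf_eq (Z.sup ℓ) (Zᶜ.sup ℓ)
  rw [hsup, finrank_top, hr] at hdim
  have hinf : Z.sup ℓ ⊓ Zᶜ.sup ℓ = ⊥ := Submodule.finrank_eq_zero.1 (by omega)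
  rcases hD.eq_bot_or_eq_bot ⟨disjoint_iff.2 hinf, codisjoint_iff.2 hsup⟩ hmem' with h | h
  · have : v h₀ ∈ Z.sup ℓ := Finset.le_sup (f := ℓ) hZ₀ (Submodule.mem_span_singleton_self _)
    rw [h] at this
    exact hv _ this
  · have : v h₁ ∈ Zᶜ.sup ℓ := Finset.le_sup (f := ℓ) hZ₁ (Submodule.mem_span_singleton_self _)
    rw [h] at this
    exact hv _ this

/-- Full support of all non-trivial relations says that the lines are a projective frame: the first
`#J - 1` vectors are a basis, and the last vector has no zero coordinate in it. -/
theorem Indecomposable.iso_flagD {D : MultiFlag 𝕜 m} (hD : D.Indecomposable)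
    {J : Finset (Fin m)} (hJ : 2 ≤ J.card) (hdim : D.dim = dimVec J (J.card - 1)) :
    D.Iso (flagD 𝕜 J) := by
  have hV : Module.finrank 𝕜 D.V = J.card - 1 := congrArg Prod.fst hdim
  have hrank : ∀ i, Module.finrank 𝕜 (D.sub i) = if i ∈ J then 1 else 0 :=
    fun i => congrFun (congrArg Prod.snd hdim) i
  have hrank₁ : ∀ i, Module.finrank 𝕜 (D.sub i) ≤ 1 := fun i => by
    rw [hrank]
    split_ifs <;> omega
  choose w hw using fun i => exists_span_singleton (hrank₁ i)
  have hw₀ : ∀ i ∈ J, w i ≠ 0 := by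
    intro i hi h
    have h₁ := hrank i
    rw [hw i, h, if_pos hi, Submodule.span_zero_singleton, finrank_bot] at h₁
    exact zero_ne_one h₁
  have hbot : ∀ i ∉ J, D.sub i = ⊥ := fun i hi =>
    Submodule.finrank_eq_zero.1 (by rw [hrank, if_neg hi])
  obtain ⟨i₀, hi₀⟩ := Finset.card_pos.1 (by omega : 0 < J.card)
  have htop : ⨆ i, D.sub i = ⊤ := hD.iSup_sub_eq_top (i := i₀) (fun h => hw₀ i₀ hi₀ (by
    rw [hw] at h
    simpa using h))
  have hcard : J.card - 1 + 1 = J.card := by omega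
  let v : Fin (J.card - 1 + 1) → D.V := fun h => w (enum J (Fin.cast hcard h))
  have hv : ∀ h, v h ≠ 0 := fun h => hw₀ _ (enum_mem J _)
  have hsub : ∀ i, ∃ h, D.sub i ≤ 𝕜 ∙ v h := by
    intro i
    by_cases hi : i ∈ J
    · obtain ⟨h, rfl⟩ := exists_enum_eq hi
      exact ⟨Fin.cast hcard.symm h, (hw _).le⟩
    · exact ⟨0, by rw [hbot i hi]; exact bot_le⟩
  have hrel := fun (c : Fin (J.card - 1 + 1) → 𝕜) => hD.ne_zero_of_relation hV hv hsub htop (c := c)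
  have hli : LinearIndependent 𝕜 fun h : Fin (J.card - 1) => v h.castSucc := by
    rw [Fintype.linearIndependent_iff]
    intro c hc h
    by_contra hch
    -- A relation between the first vectors, extended by the coefficient 0 at the last one, does not
    -- have full support.
    refine hrel (Fin.snoc (α := fun _ => 𝕜) c 0) ?_ (h₀ := h.castSucc) ?_ (Fin.last _) ?_
    · rw [Fin.sum_univ_castSucc]
      simpa using hc
    · simpa using hch
    · simp
  let β := basisOfLinearIndependentOfCardEqFinrank' (fun h : Fin (J.card - 1) => v h.castSucc) hli
    (by rw [hV, Fintype.card_fin])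
  have hβ : ∀ h, β h = v h.castSucc := fun h =>
    congrFun (coe_basisOfLinearIndependentOfCardEqFinrank' _ hli _) h
  have hc : ∀ h, β.repr (v (Fin.last _)) h ≠ 0 := by
    intro h hh
    -- The expansion of the last vector in the basis is a relation with coefficient `-1` there; a
    -- zero coordinate would again violate full support.
    refine hrel (Fin.snoc (α := fun _ => 𝕜) (fun h => β.repr (v (Fin.last _)) h) (-1)) ?_
      (h₀ := Fin.last _) ?_ h.castSucc ?_
    · rw [Fin.sum_univ_castSucc]
      simp only [Fin.snoc_castSucc, Fin.snoc_last, neg_smul, one_smul]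
      rw [add_neg_eq_zero]
      conv_rhs => rw [← β.sum_repr (v (Fin.last _))]
      exact Finset.sum_congr rfl fun h _ => by rw [hβ]
    · simp
    · simpa using hh
  have : IsEmpty (Fin (J.card - (J.card - 1) - 1)) := by
    rw [show J.card - (J.card - 1) - 1 = 0 by omega]
    infer_instance
  rw [flagD_eq_flagE J (by omega) isEmptyElim]
  refine iso_flagE (by omega) (fun i _ => hw i) hbot β (fun h => (hβ h).symm) hc isEmptyElim

theorem iso_flagF {D : MultiFlag 𝕜 m} {I : Finset (Fin m)} (hdim : D.dim = dimVec I 1) :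
    D.Iso (flagF 𝕜 I) := by
  have hV : Module.finrank 𝕜 D.V = 1 := congrArg Prod.fst hdim
  have hrank : ∀ i, Module.finrank 𝕜 (D.sub i) = if i ∈ I then 1 else 0 :=
    fun i => congrFun (congrArg Prod.snd hdim) i
  let e : D.V ≃ₗ[𝕜] 𝕜 := LinearEquiv.ofFinrankEq _ _ (hV.trans (Module.finrank_self 𝕜).symm)
  refine ⟨e, fun i => ?_⟩
  change _ = subF 𝕜 I i
  have h := hrank i
  by_cases hi : i ∈ I
  · rw [if_pos hi] at h
    rw [subF, if_pos hi, Submodule.eq_top_of_finrank_eq (h.trans hV.symm)]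
    simp
  · rw [if_neg hi] at h
    rw [subF, if_neg hi, Submodule.finrank_eq_zero.1 h, Submodule.map_bot]

end MultiFlag

/-! ### The flags F(p, q), and coordinates of direct sums -/

namespace SplitType

variable {𝕜 : Type u} [Field 𝕜] {n m : ℕ}

theorem repSummand_dim (p : SplitType n m) (q : p.Param 𝕜) (y : p.Index) :
    (p.repSummand q y).dim = p.summandDim y := by
  rcases y with k | a | b | c
  · exact flagF_dim ∅
  · exact flagF_dim _
  · have := p.card_J _ b.2
    have he : IsEmpty (Fin (b.1.card - (b.1.card - 1) - 1)) := by
      rw [show b.1.card - (b.1.card - 1) - 1 = 0 by omega]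
      infer_instance
    change (MultiFlag.flagD 𝕜 b.1).dim = MultiFlag.dimVec b.1 (b.1.card - 1)
    rw [MultiFlag.flagD_eq_flagE b.1 (by omega) isEmptyElim]
    exact MultiFlag.flagE_dim (by omega) (by omega) _
  · have := p.card_K _ c.2
    exact MultiFlag.flagE_dim (by omega) (by omega) _

theorem repSummand_indecomposable (p : SplitType n m) (q : p.Param 𝕜) (y : p.Index) :
    (p.repSummand q y).Indecomposable := by
  rcases y with k | a | b | c
  · exact flagF_indecomposable ∅
  · exact flagF_indecomposable _
  · have := p.card_J _ b.2
    have he : IsEmpty (Fin (b.1.card - (b.1.card - 1) - 1)) := by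
      rw [show b.1.card - (b.1.card - 1) - 1 = 0 by omega]
      infer_instance
    change (MultiFlag.flagD 𝕜 b.1).Indecomposable
    rw [MultiFlag.flagD_eq_flagE b.1 (by omega) isEmptyElim]
    exact MultiFlag.flagE_indecomposable (by omega) (by omega) _
  · have := p.card_K _ c.2
    exact MultiFlag.flagE_indecomposable (by omega) (by omega) _

theorem rep_isConstructible (p : SplitType n m) (q : p.Param 𝕜) : p.IsConstructible (p.rep q) :=
  ⟨p.repSummand q, fun y => ⟨p.repSummand_dim q y, p.repSummand_indecomposable q y⟩,
    MultiFlag.Iso.refl _⟩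

/-- The summands of types `∅`, `I` and `J` are determined by their dimensions. -/
theorem iso_repSummand {p : SplitType n m} (q : p.Param 𝕜) {D : MultiFlag 𝕜 m} {y : p.Index}
    (hD : D.Indecomposable) (hdim : D.dim = p.summandDim y)
    (hy : ∀ c, y ≠ .inr (.inr (.inr c))) : D.Iso (p.repSummand q y) := by
  rcases y with k | a | b | c
  · exact MultiFlag.iso_flagF hdim
  · exact MultiFlag.iso_flagF hdim
  · have := p.card_J _ b.2
    exact hD.iso_flagD (by omega) hdim
  · exact absurd rfl (hy c)

theorem blockOf_enum (p : SplitType n m) (c : p.K) (h : Fin c.1.1.card) :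
    p.blockOf (MultiFlag.enum c.1.1 h) = .inr (.inr c) :=
  (p.mem_blk_iff.1 (MultiFlag.enum_mem c.1.1 h)).symm

theorem mem_iff_of_K (p : SplitType n m) (c : p.K) (i : Fin m) :
    i ∈ c.1.1 ↔ p.blockOf i = .inr (.inr c) :=
  (p.mem_blk_iff (b := .inr (.inr c))).trans eq_comm

/-- The flags `F(p, q)` for different `q` are not isomorphic. -/
theorem rep_injective {p : SplitType n m} {q q' : p.Param 𝕜} (h : (p.rep q).Iso (p.rep q')) :
    q = q' := by
  obtain ⟨f, hf⟩ := h
  funext c j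
  have hKr := p.card_K _ c.2
  have hrK : c.1.2 < c.1.1.card := by omega
  let y : p.Index := .inr (.inr (.inr c))
  -- The diagonal component of the isomorphism at block `c`. It maps each line of the frame to the
  -- same line, which will force it to be a scalar.
  let T : (Fin c.1.2 → 𝕜) →ₗ[𝕜] (Fin c.1.2 → 𝕜) :=
    LinearMap.proj (φ := fun y => (p.repSummand q' y).V) y ∘ₗ f.toLinearMap ∘ₗ
      LinearMap.single 𝕜 (fun y => (p.repSummand q y).V) y
  have hmem : ∀ i, ∀ u ∈ MultiFlag.subE c.1.1 c.1.2 (q c) i,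
      f (Pi.single (M := fun y => (p.repSummand q y).V) y u) ∈ (p.rep q').sub i := fun i u hu =>
    (MultiFlag.mem_sub_iff_of_map_eq (hf i) _).2 (single_mem (S := p.repSummand q) hu)
  have hT : ∀ i, ∀ u ∈ MultiFlag.subE c.1.1 c.1.2 (q c) i, T u ∈ MultiFlag.subE c.1.1 c.1.2 (q' c) i :=
    fun i u hu => hmem i u hu y (Set.mem_univ y)
  -- The image of a line of the block has no components in other summands, so on these lines `T`
  -- loses nothing and inherits injectivity from `f`.
  have hT₀ : ∀ i ∈ c.1.1, ∀ u ∈ MultiFlag.subE c.1.1 c.1.2 (q c) i, T u = 0 → u = 0 := by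
    intro i hi u hu h0
    have h₁ := eq_single_of_mem (p.repSummand_dim q') (hmem i u hu)
    have hy : (Sum.inr (p.blockOf i) : p.Index) = y := congrArg Sum.inr ((p.mem_iff_of_K c i).1 hi)
    rw [hy] at h₁
    have h₂ : f (Pi.single (M := fun y => (p.repSummand q y).V) y u) y = 0 := h0
    rw [h₂, Pi.single_zero] at h₁
    have h₃ := congrFun (f.injective (h₁.trans (map_zero f).symm)) y
    exact (Pi.single_eq_same (M := fun y => (p.repSummand q y).V) y u).symm.trans h₃
  have hsingle : ∀ k : Fin c.1.2, ∃ a : 𝕜, T (Pi.single k 1) = a • Pi.single k 1 := by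
    intro k
    have := hT (MultiFlag.enum c.1.1 ⟨k, k.2.trans hrK⟩) (Pi.single k 1)
    rw [MultiFlag.subE_of_lt, MultiFlag.subE_of_lt] at this
    obtain ⟨a, ha⟩ := Submodule.mem_span_singleton.1 (this (Submodule.mem_span_singleton_self _))
    exact ⟨a, ha.symm⟩
  choose a ha using hsingle
  obtain ⟨b, hb⟩ : ∃ b : 𝕜, T (fun _ => 1) = b • fun _ => 1 := by
    have := hT (MultiFlag.enum c.1.1 ⟨c.1.2, hrK⟩) (fun _ => 1)
    rw [MultiFlag.subE_of_eq, MultiFlag.subE_of_eq] at this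
    obtain ⟨b, hb⟩ := Submodule.mem_span_singleton.1 (this (Submodule.mem_span_singleton_self _))
    exact ⟨b, hb.symm⟩
  have hTv : ∀ v : Fin c.1.2 → 𝕜, ∀ k, T v k = a k * v k := by
    intro v k
    conv_lhs => rw [← Finset.univ_sum_single v]
    rw [map_sum, Finset.sum_apply, Finset.sum_eq_single k]
    · have : (Pi.single k (v k) : Fin c.1.2 → 𝕜) = v k • Pi.single k 1 := by
        rw [← Pi.single_smul, smul_eq_mul, mul_one]
      rw [this, map_smul, ha]
      simp [mul_comm]
    · intro l _ hl
      have : (Pi.single l (v l) : Fin c.1.2 → 𝕜) = v l • Pi.single l 1 := by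
        rw [← Pi.single_smul, smul_eq_mul, mul_one]
      rw [this, map_smul, ha]
      simp [Pi.single_eq_of_ne hl.symm]
    · simp
  -- Preserving the axes makes `T` diagonal; preserving the line of `(1, …, 1)` makes the diagonal
  -- entries equal.
  have hab : ∀ k, a k = b := by
    intro k
    have h₁ := hTv (fun _ => 1) k
    rw [hb] at h₁
    simpa using h₁.symm
  have hTb : ∀ v, T v = b • v := by
    intro v
    funext k
    rw [hTv, hab]
    rfl
  have hb₀ : b ≠ 0 := by
    intro h0
    have := hT₀ (MultiFlag.enum c.1.1 ⟨c.1.2, hrK⟩) (MultiFlag.enum_mem c.1.1 _) (fun _ => 1) (by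
      rw [MultiFlag.subE_of_eq]
      exact Submodule.mem_span_singleton_self _) (by rw [hTb, h0, zero_smul])
    exact one_ne_zero (congrFun this ⟨0, by omega⟩)
  apply Projectivization.submodule_injective
  have hj : c.1.2 + 1 + (j : ℕ) < c.1.1.card := by
    omega
  refine Submodule.eq_of_le_of_finrank_eq (fun v hv => ?_) ?_
  · have h₁ := hT (MultiFlag.enum c.1.1 ⟨c.1.2 + 1 + j, hj⟩) v
    have e₁ := MultiFlag.subE_of_gt (q c) j hj
    have e₂ := MultiFlag.subE_of_gt (q' c) j hj
    rw [e₁, e₂, hTb] at h₁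
    exact (Submodule.smul_mem_iff _ hb₀).1 (h₁ hv)
  · exact (Projectivization.finrank_submodule _).trans (Projectivization.finrank_submodule _).symm

/-- A decomposition of the whole space that is compatible with the lines spanned by the vectors
`v i` decomposes the flag of these lines. -/
theorem iso_directSum_span {D : MultiFlag 𝕜 m} {ι : Type} [Finite ι] [DecidableEq ι]
    (W : ι → Type u) [∀ y, AddCommGroup (W y)] [∀ y, Module 𝕜 (W y)]
    [∀ y, FiniteDimensional 𝕜 (W y)] (f : D.V ≃ₗ[𝕜] ∀ y, W y) (v : Fin m → D.V)
    (hv : ∀ i, D.sub i = 𝕜 ∙ v i) (hf : ∀ i, ∃ y, ∀ z, z ≠ y → f (v i) z = 0) :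
    D.Iso (MultiFlag.directSum fun y =>
      { V := W y, sub := fun i => 𝕜 ∙ f (v i) y }) := by
  refine ⟨f, fun i => ?_⟩
  rw [hv, Submodule.map_span, Set.image_singleton]
  apply le_antisymm
  · rw [Submodule.span_singleton_le_iff_mem]
    exact fun y _ => Submodule.mem_span_singleton_self _
  · intro w hw
    obtain ⟨y, hy⟩ := hf i
    obtain ⟨c, hc⟩ := Submodule.mem_span_singleton.1 (hw y (Set.mem_univ y))
    refine Submodule.mem_span_singleton.2 ⟨c, ?_⟩
    funext z
    rcases eq_or_ne z y with rfl | h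
    · exact hc
    · obtain ⟨d, hd⟩ := Submodule.mem_span_singleton.1 (hw z (Set.mem_univ z))
      have h0 : f (v i) z = 0 := hy z h
      simp only [h0, smul_zero] at hd
      change c • f (v i) z = w z
      rw [h0, smul_zero]
      exact hd

/-- The subspaces of the summands are spanned by the components of the lines. -/
theorem sub_eq_span_apply {p : SplitType n m} {S : p.Index → MultiFlag 𝕜 m} {F : MultiFlag 𝕜 m}
    {f : F.V ≃ₗ[𝕜] (MultiFlag.directSum S).V}
    (hf : ∀ i, (F.sub i).map f.toLinearMap = (MultiFlag.directSum S).sub i)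
    {i : Fin m} {v : F.V} (hv : F.sub i = 𝕜 ∙ v) (y : p.Index) : (S y).sub i = 𝕜 ∙ f v y := by
  apply le_antisymm
  · intro u hu
    have := symm_single_mem hf hu
    rw [hv] at this
    obtain ⟨c, hc⟩ := Submodule.mem_span_singleton.1 this
    refine Submodule.mem_span_singleton.2 ⟨c, ?_⟩
    have h := congrFun (congrArg f hc) y
    rwa [LinearEquiv.apply_symm_apply, Pi.single_eq_same, map_smul] at h
  · rw [Submodule.span_singleton_le_iff_mem]
    exact apply_mem hf (hv ▸ Submodule.mem_span_singleton_self v) y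

/-- Cramer's rule for the coordinates with respect to a family of vectors. -/
theorem exists_basis_cramer {V : Type*} [AddCommGroup V] [Module 𝕜 V] {r : ℕ}
    (hV : Module.finrank 𝕜 V = r) (hr : 0 < r) (G : V →ₗ[𝕜] (Fin r → 𝕜)) (u : Fin r → V)
    (hdet : (Matrix.of fun k h => G (u h) k).det ≠ 0) :
    ∃ β : Module.Basis (Fin r) 𝕜 V, (∀ h, u h = β h) ∧ ∀ z h,
      Matrix.cramer (Matrix.of fun k h => G (u h) k) (G z) h =
        (Matrix.of fun k h => G (u h) k).det * β.repr z h := by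
  have : FiniteDimensional 𝕜 V := Module.finite_of_finrank_pos (by omega)
  have hmul : ∀ c : Fin r → 𝕜,
      G (∑ h, c h • u h) = (Matrix.of fun k h => G (u h) k).mulVec c := by
    intro c
    funext k
    rw [map_sum, Finset.sum_apply]
    simp [Matrix.mulVec, dotProduct, mul_comm]
  have hli : LinearIndependent 𝕜 u := by
    rw [Fintype.linearIndependent_iff]
    intro c hc
    have := hmul c
    rw [hc, map_zero] at this
    exact congrFun (Matrix.eq_zero_of_mulVec_eq_zero hdet this.symm)
  let β := basisOfLinearIndependentOfCardEqFinrank' u hli (by rw [hV, Fintype.card_fin])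
  have hβ : ∀ h, u h = β h := fun h =>
    (congrFun (coe_basisOfLinearIndependentOfCardEqFinrank' _ hli _) h).symm
  refine ⟨β, hβ, fun z h => ?_⟩
  -- `G z` is the frame matrix applied to the coordinates of `z`, so multiplying by the adjugate
  -- returns the coordinates times the determinant.
  have hz : G z = (Matrix.of fun k h => G (u h) k).mulVec (β.repr z) := by
    rw [← hmul]
    conv_lhs => rw [← β.sum_repr z]
    simp only [hβ]
  rw [hz, Matrix.cramer_eq_adjugate_mulVec, Matrix.mulVec_mulVec, Matrix.adjugate_mul,
    Matrix.smul_mulVec, Matrix.one_mulVec]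
  rfl

end SplitType

/-! ### Topology of projective spaces and orbit spaces -/

namespace Projectivization

theorem map_submodule {𝕜 V W : Type*} [Field 𝕜] [AddCommGroup V] [Module 𝕜 V]
    [AddCommGroup W] [Module 𝕜 W] {f : V →ₗ[𝕜] W} (hf : Function.Injective f) (x : ℙ 𝕜 V) :
    (map f hf x).submodule = x.submodule.map f := by
  induction x using Projectivization.ind with
  | h v hv => rw [map_mk, submodule_mk, submodule_mk, Submodule.map_span, Set.image_singleton]

variable {𝕜 V W : Type*} [Field 𝕜]
  [AddCommGroup V] [Module 𝕜 V] [TopologicalSpace V] [AddCommGroup W] [Module 𝕜 W]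
  [TopologicalSpace W]

theorem continuous_mk' : Continuous (mk' 𝕜 : { v : V // v ≠ 0 } → ℙ 𝕜 V) :=
  continuous_quotient_mk'

/-- The saturation of an open set is the union of its preimages under scalings by units, each of
which is open. -/
theorem isOpenMap_mk' [ContinuousConstSMul 𝕜 V] :
    IsOpenMap (mk' 𝕜 : { v : V // v ≠ 0 } → ℙ 𝕜 V) := by
  intro U hU
  have hq : Topology.IsQuotientMap (mk' 𝕜 : { v : V // v ≠ 0 } → ℙ 𝕜 V) := isQuotientMap_quot_mk
  rw [← hq.isOpen_preimage]
  have hsm : ∀ a : 𝕜ˣ, Continuous fun v : { v : V // v ≠ 0 } =>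
      (⟨(a : 𝕜) • v.1, smul_ne_zero a.ne_zero v.2⟩ : { v : V // v ≠ 0 }) := fun a =>
    (continuous_subtype_val.const_smul (a : 𝕜)).subtype_mk _
  have : mk' 𝕜 ⁻¹' (mk' 𝕜 '' U) = ⋃ a : 𝕜ˣ, (fun v : { v : V // v ≠ 0 } =>
      (⟨(a : 𝕜) • v.1, smul_ne_zero a.ne_zero v.2⟩ : { v : V // v ≠ 0 })) ⁻¹' U := by
    ext v
    simp only [Set.mem_preimage, Set.mem_image, Set.mem_iUnion]
    constructor
    · rintro ⟨w, hw, hwv⟩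
      rw [mk'_eq_mk, mk'_eq_mk, mk_eq_mk_iff] at hwv
      obtain ⟨a, ha⟩ := hwv
      refine ⟨a, ?_⟩
      convert hw using 1
      exact Subtype.ext ha
    · rintro ⟨a, ha⟩
      refine ⟨_, ha, ?_⟩
      rw [mk'_eq_mk, mk'_eq_mk, mk_eq_mk_iff]
      exact ⟨a, rfl⟩
  rw [this]
  exact isOpen_iUnion fun a => hU.preimage (hsm a)

theorem continuous_map {f : V →ₗ[𝕜] W} (hf : Function.Injective f) (hc : Continuous f) :
    Continuous (map f hf : ℙ 𝕜 V → ℙ 𝕜 W) := by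
  have hq : Topology.IsQuotientMap (mk' 𝕜 : { v : V // v ≠ 0 } → ℙ 𝕜 V) := isQuotientMap_quot_mk
  rw [hq.continuous_iff]
  have : map f hf ∘ mk' 𝕜 = mk' 𝕜 ∘ fun v : { v : V // v ≠ 0 } =>
      (⟨f v.1, fun h => v.2 (hf (h.trans (map_zero f).symm))⟩ : { w : W // w ≠ 0 }) := rfl
  rw [this]
  exact continuous_mk'.comp ((hc.comp continuous_subtype_val).subtype_mk _)

/-- A neighborhood of a tuple of points contains the points spanned by nearby vectors. -/
theorem eventually_mk_mem {ι : Type*} [Finite ι] {x : ι → ℙ 𝕜 V} {v : ι → V} (hv : ∀ i, v i ≠ 0)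
    (hx : ∀ i, x i = mk 𝕜 (v i) (hv i)) {N : Set (ι → ℙ 𝕜 V)} (hN : N ∈ nhds x) :
    ∀ᶠ w in nhds v, ∀ hw : ∀ i, w i ≠ 0, (fun i => mk 𝕜 (w i) (hw i)) ∈ N := by
  let mks : (ι → { v : V // v ≠ 0 }) → ι → ℙ 𝕜 V := fun w i => mk' 𝕜 (w i)
  have hmks : Continuous mks := continuous_pi fun i => continuous_mk'.comp (continuous_apply i)
  let w₀ : ι → { v : V // v ≠ 0 } := fun i => ⟨v i, hv i⟩
  have hw₀ : mks w₀ = x := funext fun i => (hx i).symm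
  have hpre : mks ⁻¹' N ∈ nhds w₀ := hmks.continuousAt.preimage_mem_nhds (by rwa [hw₀])
  have hind : Topology.IsInducing (Pi.map fun (_ : ι) (v : { v : V // v ≠ 0 }) => (v : V)) :=
    Topology.IsInducing.piMap fun _ => Topology.IsInducing.subtypeVal
  rw [hind.nhds_eq_comap, Filter.mem_comap] at hpre
  obtain ⟨t, ht, htN⟩ := hpre
  refine Filter.mem_of_superset ht fun w hwt hw => ?_
  exact htN (show (fun i => (⟨w i, hw i⟩ : { v : V // v ≠ 0 })) ∈ _ from hwt)

/-- The points spanned by vectors near a given tuple form a neighborhood. -/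
theorem mk_mem_nhds [ContinuousConstSMul 𝕜 V] {ι : Type*} [Finite ι] {x : ι → ℙ 𝕜 V} {v : ι → V}
    (hv : ∀ i, v i ≠ 0) (hx : ∀ i, x i = mk 𝕜 (v i) (hv i)) {U : Set (ι → V)} (hU : U ∈ nhds v) :
    { y | ∃ w ∈ U, ∃ hw : ∀ i, w i ≠ 0, y = fun i => mk 𝕜 (w i) (hw i) } ∈ nhds x := by
  let mks : (ι → { v : V // v ≠ 0 }) → ι → ℙ 𝕜 V := Pi.map fun _ => mk' 𝕜
  have hmks : IsOpenMap mks := by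
    refine IsOpenMap.piMap (fun _ => isOpenMap_mk') ?_
    exact Filter.Eventually.of_forall fun _ => Quot.mk_surjective
  let w₀ : ι → { v : V // v ≠ 0 } := fun i => ⟨v i, hv i⟩
  have hw₀ : mks w₀ = x := funext fun i => (hx i).symm
  have hval : Continuous fun (w : ι → { v : V // v ≠ 0 }) i => (w i : V) :=
    continuous_pi fun i => continuous_subtype_val.comp (continuous_apply i)
  have hpre : (fun (w : ι → { v : V // v ≠ 0 }) i => (w i : V)) ⁻¹' U ∈ nhds w₀ :=
    hval.continuousAt.preimage_mem_nhds hU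
  refine Filter.mem_of_superset (hw₀ ▸ hmks.image_mem_nhds hpre) ?_
  rintro _ ⟨w, hw, rfl⟩
  exact ⟨_, hw, fun i => (w i).2, rfl⟩

end Projectivization

section Orbit

variable {𝕜 : Type u} [RCLike 𝕜] {n m : ℕ}

theorem isOpenMap_orbitOf : IsOpenMap (orbitOf : (Fin m → ℙ 𝕜 (Fin n → 𝕜)) → OrbitSpace 𝕜 n m) := by
  have : ContinuousConstSMul (LinearMap.GeneralLinearGroup 𝕜 (Fin n → 𝕜))
      (ℙ 𝕜 (Fin n → 𝕜)) := by
    refine ⟨fun g => ?_⟩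
    exact Projectivization.continuous_map (f := g.toLinearEquiv.toLinearMap)
      g.toLinearEquiv.injective (LinearMap.continuous_of_finiteDimensional _)
  exact isOpenMap_quotient_mk'_mul

theorem continuous_orbitOf :
    Continuous (orbitOf : (Fin m → ℙ 𝕜 (Fin n → 𝕜)) → OrbitSpace 𝕜 n m) :=
  continuous_quotient_mk'

end Orbit

theorem orbitOf_eq_iff {𝕜 : Type u} [Field 𝕜] {n m : ℕ} {x y : Fin m → ℙ 𝕜 (Fin n → 𝕜)} :
    orbitOf x = orbitOf y ↔ (MultiFlag.ofPoints x).Iso (MultiFlag.ofPoints y) := by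
  have hsmul : ∀ (g : LinearMap.GeneralLinearGroup 𝕜 (Fin n → 𝕜)) (z : ℙ 𝕜 (Fin n → 𝕜)),
      (g • z).submodule = z.submodule.map g.toLinearEquiv.toLinearMap := fun g z =>
    by
      induction z using Projectivization.ind with
      | h v hv =>
        rw [Projectivization.generalLinearGroup_smul_def, Projectivization.map_mk,
          Projectivization.submodule_mk, Projectivization.submodule_mk, Submodule.map_span,
          Set.image_singleton]
  rw [orbitOf, orbitOf, Quotient.eq, MulAction.orbitRel_apply]
  constructor
  · rintro ⟨g, rfl⟩
    exact MultiFlag.Iso.symm ⟨g.toLinearEquiv, fun i => (hsmul g (y i)).symm⟩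
  · intro h
    obtain ⟨f, hf⟩ := h.symm
    refine ⟨LinearMap.GeneralLinearGroup.ofLinearEquiv f, funext fun i => ?_⟩
    apply Projectivization.submodule_injective
    change (LinearMap.GeneralLinearGroup.ofLinearEquiv f • y i).submodule = _
    rw [hsmul]
    exact hf i

open Polynomial in
/-- A pencil of matrices with an invertible member at infinity is generically invertible. -/
theorem eventually_det_add_smul_ne_zero {𝕜 : Type*} [RCLike 𝕜] {r : ℕ}
    (M N : Matrix (Fin r) (Fin r) 𝕜) (hN : N.det ≠ 0) :
    ∀ᶠ t in nhdsWithin (0 : 𝕜) {0}ᶜ, (M + t • N).det ≠ 0 := by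
  -- Factoring out `N` turns the determinant into a characteristic polynomial in `t`. It is monic,
  -- so it has finitely many roots, and 0 is isolated from the others.
  have hdet : ∀ t, (M + t • N).det = N.det * (Matrix.charpoly (-(N⁻¹ * M))).eval t := by
    intro t
    rw [Matrix.eval_charpoly, ← Matrix.det_mul]
    congr 1
    have hNN : N * N⁻¹ = 1 := Matrix.mul_nonsing_inv _ (isUnit_iff_ne_zero.2 hN)
    rw [sub_neg_eq_add, Matrix.mul_add, ← Matrix.mul_assoc, hNN, Matrix.one_mul, add_comm]
    congr 1
    rw [Matrix.scalar_apply, ← Matrix.smul_one_eq_diagonal, Matrix.mul_smul, Matrix.mul_one]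
  have hfin : {t | (Matrix.charpoly (-(N⁻¹ * M))).eval t = 0}.Finite :=
    (Matrix.charpoly (-(N⁻¹ * M))).finite_setOfPred_isRoot (Matrix.charpoly_monic _).ne_zero
  have hev := (hfin.sdiff (t := {0})).isClosed.isOpen_compl.mem_nhds
    (show (0 : 𝕜) ∈ ({t | (Matrix.charpoly (-(N⁻¹ * M))).eval t = 0} \ {0})ᶜ by simp)
  filter_upwards [nhdsWithin_le_nhds hev, self_mem_nhdsWithin] with t ht ht₀ h
  rw [hdet] at h
  exact ht ⟨(mul_eq_zero.1 h).resolve_left hN, ht₀⟩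

/-! ### Continuity of the parametrization -/

namespace SplitType

variable {𝕜 : Type u} [RCLike 𝕜] {n m : ℕ}

instance (p : SplitType n m) : Nonempty (p.Param 𝕜) := by
  refine ⟨fun c _ => Projectivization.mk 𝕜 (fun _ => 1) fun h => ?_⟩
  have := p.card_K _ c.2
  exact one_ne_zero (congrFun h ⟨0, by omega⟩)

/-- The whole spaces of `F(p, q)` and `F(p, q')` agree summand by summand. -/
def repSummandEquiv (p : SplitType n m) (q q' : p.Param 𝕜) :
    ∀ y, (p.repSummand q y).V ≃ₗ[𝕜] (p.repSummand q' y).V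
  | .inl _ => LinearEquiv.refl 𝕜 𝕜
  | .inr (.inl _) => LinearEquiv.refl 𝕜 𝕜
  | .inr (.inr (.inl b)) => LinearEquiv.refl 𝕜 (Fin (b.1.card - 1) → 𝕜)
  | .inr (.inr (.inr c)) => LinearEquiv.refl 𝕜 (Fin c.1.2 → 𝕜)

/-- The flags `F(p, q)` are realized by points that depend continuously on `q`. -/
theorem exists_continuous_points (p : SplitType n m) :
    ∃ X : p.Param 𝕜 → Fin m → ℙ 𝕜 (Fin n → 𝕜), Continuous X ∧
      ∀ q, (MultiFlag.ofPoints (X q)).Iso (p.rep q) := by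
  obtain ⟨q₀⟩ : Nonempty (p.Param 𝕜) := inferInstance
  have hfin : Module.finrank 𝕜 (∀ y, (p.repSummand q₀ y).V) = Module.finrank 𝕜 (Fin n → 𝕜) :=
    (finrank_directSum (p.repSummand_dim q₀)).trans (Module.finrank_fin_fun 𝕜).symm
  -- One identification with `𝕜ⁿ`, chosen at `q₀`, serves all `q`, because the whole spaces of the
  -- summands do not depend on `q`.
  let L : (∀ y, (p.repSummand q₀ y).V) ≃ₗ[𝕜] (Fin n → 𝕜) := LinearEquiv.ofFinrankEq _ _ hfin
  let g : ∀ y, (p.repSummand q₀ y).V →ₗ[𝕜] (Fin n → 𝕜) := fun y =>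
    L.toLinearMap ∘ₗ LinearMap.single 𝕜 (fun y => (p.repSummand q₀ y).V) y
  have hg : ∀ y, Function.Injective (g y) := fun y =>
    L.injective.comp (Pi.single_injective (M := fun y => (p.repSummand q₀ y).V) y)
  let f : ∀ q, (∀ y, (p.repSummand q y).V) ≃ₗ[𝕜] (Fin n → 𝕜) := fun q =>
    (LinearEquiv.piCongrRight (p.repSummandEquiv q q₀)).trans L
  have hf : ∀ q y (u : (p.repSummand q y).V),
      f q (Pi.single (M := fun y => (p.repSummand q y).V) y u) =
        g y (p.repSummandEquiv q q₀ y u) := by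
    intro q y u
    change L _ = L _
    congr 1
    funext z
    change p.repSummandEquiv q q₀ z _ = Pi.single (M := fun y => (p.repSummand q₀ y).V) y _ z
    rcases eq_or_ne z y with rfl | h
    · rw [Pi.single_eq_same, Pi.single_eq_same]
    · rw [Pi.single_eq_of_ne h, Pi.single_eq_of_ne h, map_zero]
  have hmap : ∀ q i, ((p.rep q).sub i).map (f q).toLinearMap =
      (((p.repSummand q (.inr (p.blockOf i))).sub i).map
        (p.repSummandEquiv q q₀ (.inr (p.blockOf i))).toLinearMap).map
          (g (.inr (p.blockOf i))) := by
    intro q i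
    apply le_antisymm
    · rintro _ ⟨w, hw, rfl⟩
      refine ⟨_, ⟨w (.inr (p.blockOf i)), hw _ (Set.mem_univ _), rfl⟩, ?_⟩
      refine (hf q _ _).symm.trans ?_
      rw [← eq_single_of_mem (p.repSummand_dim q) hw]
      rfl
    · rintro _ ⟨_, ⟨u, hu, rfl⟩, rfl⟩
      exact ⟨_, single_mem (S := p.repSummand q) hu, hf q _ _⟩
  have hrank : ∀ q i, Module.finrank 𝕜 (((p.rep q).sub i).map (f q).toLinearMap) = 1 := by
    intro q i
    rw [hmap, (Submodule.equivMapOfInjective _ (hg _) _).finrank_eq.symm,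
      LinearEquiv.finrank_map_eq, finrank_sub (p.repSummand_dim q), if_pos (p.mem_blk_blockOf i)]
  refine ⟨fun q i => Projectivization.mk'' _ (hrank q i), ?_, fun q => ?_⟩
  · refine continuous_pi fun i => ?_
    obtain ⟨b, hb⟩ : ∃ b, b = p.blockOf i := ⟨_, rfl⟩
    have hi := p.mem_blk_iff.2 hb
    -- All lines outside the parameter positions of the K-blocks are independent of `q`.
    have hconst : (∀ q, (((p.repSummand q (.inr b)).sub i).map
        (p.repSummandEquiv q q₀ (.inr b)).toLinearMap) = (p.repSummand q₀ (.inr b)).sub i) →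
        Continuous fun q => Projectivization.mk'' _ (hrank q i) := by
      intro h
      refine continuous_const (y := Projectivization.mk'' _ (hrank q₀ i)) |>.congr fun q => ?_
      apply Projectivization.submodule_injective
      rw [Projectivization.submodule_mk'', Projectivization.submodule_mk'', hmap, hmap, ← hb, h q,
        h q₀]
    rcases b with a | b | c
    · exact hconst fun q => Submodule.map_id _
    · exact hconst fun q => Submodule.map_id _
    · have hKr := p.card_K _ c.2
      have hrK : c.1.2 < c.1.1.card := by omega
      have hcontE : (∀ q : p.Param 𝕜, MultiFlag.subE c.1.1 c.1.2 (q c) i = MultiFlag.subE c.1.1 c.1.2 (q₀ c) i) →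
          Continuous fun q => Projectivization.mk'' _ (hrank q i) := fun h =>
        hconst fun q => (Submodule.map_id _).trans (h q)
      obtain ⟨⟨h, hK⟩, rfl⟩ := MultiFlag.exists_enum_eq (K := c.1.1) hi
      rcases lt_trichotomy h c.1.2 with hlt | rfl | hgt
      · refine hcontE fun q => ?_
        have h₁ := MultiFlag.subE_of_lt (q c) ⟨h, hlt⟩ hK
        have h₂ := MultiFlag.subE_of_lt (q₀ c) ⟨h, hlt⟩ hK
        exact h₁.trans h₂.symm
      · exact hcontE fun q => by rw [MultiFlag.subE_of_eq, MultiFlag.subE_of_eq]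
      · obtain ⟨j, rfl⟩ : ∃ j : Fin (c.1.1.card - c.1.2 - 1), h = c.1.2 + 1 + j :=
          ⟨⟨h - c.1.2 - 1, by omega⟩, by simp only; omega⟩
        -- The only moving lines: the image of the coordinate `q c j` under a fixed injective linear
        -- map.
        let G : (Fin c.1.2 → 𝕜) →ₗ[𝕜] (Fin n → 𝕜) := g (.inr (.inr (.inr c)))
        have hG : Function.Injective G := hg (.inr (.inr (.inr c)))
        have hcont : Continuous fun q : p.Param 𝕜 => Projectivization.map G hG (q c j) :=
          (Projectivization.continuous_map hG (LinearMap.continuous_of_finiteDimensional _)).comp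
            ((continuous_apply j).comp (continuous_apply c))
        refine hcont.congr fun q => ?_
        apply Projectivization.submodule_injective
        rw [Projectivization.submodule_mk'', Projectivization.map_submodule, hmap, ← hb,
          ← MultiFlag.subE_of_gt (q c) j hK]
        exact congrArg (Submodule.map G) (Submodule.map_id _).symm
  · refine MultiFlag.Iso.symm ⟨f q, fun i => ?_⟩
    exact (Projectivization.submodule_mk'' _ (hrank q i)).symm

end SplitType

/-! ### Cramer coordinates, and openness of the parametrization -/

namespace MultiFlag

/-- The matrix whose columns are the coordinate vectors of the first `r` vectors in `K`. -/
def frameMatrix {𝕜 E : Type*} {m : ℕ} {K : Finset (Fin m)} {r : ℕ} (hrK : r < K.card)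
    (T : E → Fin r → 𝕜) (v : Fin m → E) : Matrix (Fin r) (Fin r) 𝕜 :=
  Matrix.of fun k h => T (v (enum K ⟨h, h.2.trans hrK⟩)) k

variable {𝕜 : Type u} [Field 𝕜] {m : ℕ}

/-- `G` is only a device for computing: Cramer's expressions are the coordinates in the basis of the
first `r` vectors times one determinant, which cancels in the quotients. The parameters are thus
independent of `G`. -/
theorem iso_flagE_of_cramer {D : MultiFlag 𝕜 m} {K : Finset (Fin m)} {r : ℕ} (hr : 0 < r)
    (hrK : r < K.card) (hV : Module.finrank 𝕜 D.V = r)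
    {w : Fin m → D.V} (hw : ∀ i ∈ K, D.sub i = 𝕜 ∙ w i) (hw₀ : ∀ i ∉ K, D.sub i = ⊥)
    (G : D.V →ₗ[𝕜] (Fin r → 𝕜)) (hdet : (frameMatrix hrK G w).det ≠ 0)
    (hc : ∀ h, (frameMatrix hrK G w).cramer (G (w (enum K ⟨r, hrK⟩))) h ≠ 0)
    {q : Fin (K.card - r - 1) → ℙ 𝕜 (Fin r → 𝕜)}
    (hq : ∀ (j : Fin (K.card - r - 1)) (h : r + 1 + j < K.card), (q j).submodule =
      𝕜 ∙ (fun k => (frameMatrix hrK G w).cramer (G (w (enum K ⟨r + 1 + j, h⟩))) k /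
        (frameMatrix hrK G w).cramer (G (w (enum K ⟨r, hrK⟩))) k)) :
    D.Iso (flagE K r q) := by
  obtain ⟨β, hβ, hcr⟩ := SplitType.exists_basis_cramer hV hr G
    (fun h : Fin r => w (enum K ⟨h, h.2.trans hrK⟩)) hdet
  change ∀ z h, (frameMatrix hrK G w).cramer (G z) h = (frameMatrix hrK G w).det * _ at hcr
  refine iso_flagE hrK hw hw₀ β hβ (fun h h0 => hc h ?_) fun j h => ?_
  · rw [hcr, h0, mul_zero]
  · rw [hq j h]
    congr 2
    funext k
    rw [hcr, hcr, mul_div_mul_left _ _ hdet]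

theorem exists_iso_flagE_of_cramer {D : MultiFlag 𝕜 m} {K : Finset (Fin m)} {r : ℕ} (hr : 0 < r)
    (hrK : r < K.card) (hV : Module.finrank 𝕜 D.V = r)
    {w : Fin m → D.V} (hw : ∀ i ∈ K, D.sub i = 𝕜 ∙ w i) (hw₀ : ∀ i ∉ K, D.sub i = ⊥)
    (hne : ∀ i ∈ K, w i ≠ 0)
    (G : D.V →ₗ[𝕜] (Fin r → 𝕜)) (hdet : (frameMatrix hrK G w).det ≠ 0)
    (hc : ∀ h, (frameMatrix hrK G w).cramer (G (w (enum K ⟨r, hrK⟩))) h ≠ 0) :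
    ∃ q, D.Iso (flagE K r q) := by
  obtain ⟨β, hβ, hcr⟩ := SplitType.exists_basis_cramer hV hr G
    (fun h : Fin r => w (enum K ⟨h, h.2.trans hrK⟩)) hdet
  change ∀ z h, (frameMatrix hrK G w).cramer (G z) h = (frameMatrix hrK G w).det * _ at hcr
  have hvec : ∀ (j : Fin (K.card - r - 1)), (fun k =>
      (frameMatrix hrK G w).cramer (G (w (enum K ⟨r + 1 + j, by omega⟩))) k /
        (frameMatrix hrK G w).cramer (G (w (enum K ⟨r, hrK⟩))) k) ≠ 0 := by
    intro j h0
    -- A zero parameter vector would mean that all coordinates of a non-zero vector vanish.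
    refine hne _ (enum_mem K ⟨r + 1 + j, by omega⟩) ?_
    refine (LinearEquiv.map_eq_zero_iff β.repr).1 (Finsupp.ext fun k => ?_)
    have hk := (div_eq_zero_iff.1 (congrFun h0 k)).resolve_right (hc k)
    rw [hcr] at hk
    exact (mul_eq_zero.1 hk).resolve_left hdet
  exact ⟨fun j => Projectivization.mk 𝕜 _ (hvec j), iso_flagE_of_cramer hr hrK hV hw hw₀ G hdet hc
    fun j h => Projectivization.submodule_mk _ _⟩

theorem cramer_diagonal {r : ℕ} {a : Fin r → 𝕜} (ha : ∀ h, a h ≠ 0) (z : Fin r → 𝕜) (h : Fin r) :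
    (Matrix.diagonal a).cramer z h = (Matrix.diagonal a).det * (z h / a h) := by
  have hz : z = (Matrix.diagonal a).mulVec fun h => z h / a h := by
    funext k
    rw [Matrix.mulVec_diagonal, mul_div_cancel₀ _ (ha k)]
  conv_lhs => rw [hz]
  rw [Matrix.cramer_eq_adjugate_mulVec, Matrix.mulVec_mulVec, Matrix.adjugate_mul,
    Matrix.smul_mulVec, Matrix.one_mulVec]
  rfl

end MultiFlag

namespace SplitType

theorem lt_card {n m : ℕ} (p : SplitType n m) (c : p.K) : c.1.2 < c.1.1.card := by
  have := p.card_K _ c.2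
  omega

theorem snd_pos {n m : ℕ} (p : SplitType n m) (c : p.K) : 0 < c.1.2 := by
  have := p.card_K _ c.2
  omega

section Cramer

open MultiFlag

variable {𝕜 : Type u} [Field 𝕜] {n m : ℕ} {p : SplitType n m}

/-- The conditions on vectors under which Cramer's rule computes the parameters. -/
structure IsFramed (T : ∀ c : p.K, (Fin n → 𝕜) →ₗ[𝕜] (Fin c.1.2 → 𝕜))
    (v : Fin m → Fin n → 𝕜) : Prop where
  det_ne : ∀ c, (frameMatrix (p.lt_card c) (T c) v).det ≠ 0
  unit_ne : ∀ c h, (frameMatrix (p.lt_card c) (T c) v).cramer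
    (T c (v (enum c.1.1 ⟨c.1.2, p.lt_card c⟩))) h ≠ 0
  param_ne : ∀ (c : p.K) (j : Fin (c.1.1.card - c.1.2 - 1)),
    (frameMatrix (p.lt_card c) (T c) v).cramer
      (T c (v (enum c.1.1 ⟨c.1.2 + 1 + j, by omega⟩))) ≠ 0

/-- The parameters given by Cramer's rule. -/
def cramerParam {T : ∀ c : p.K, (Fin n → 𝕜) →ₗ[𝕜] (Fin c.1.2 → 𝕜)}
    (v : { v : Fin m → Fin n → 𝕜 // IsFramed T v }) : p.Param 𝕜 := fun c j =>
  Projectivization.mk' 𝕜 ⟨fun k => (frameMatrix (p.lt_card c) (T c) v.1).cramer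
      (T c (v.1 (enum c.1.1 ⟨c.1.2 + 1 + j, by omega⟩))) k /
        (frameMatrix (p.lt_card c) (T c) v.1).cramer
          (T c (v.1 (enum c.1.1 ⟨c.1.2, p.lt_card c⟩))) k, fun h => v.2.param_ne c j
    (funext fun k => (div_eq_zero_iff.1 (congrFun h k)).resolve_right (v.2.unit_ne c k))⟩

/-- The decomposition of `x` may vary without any continuity, yet the parameters depend only on `v`
and the fixed maps `T`. A vector of block `c` is recovered from its component in the `c`-th summand,
so applying `T c` to the vector or to that component gives the same frame matrix. -/
theorem iso_rep_cramerParam {T : ∀ c : p.K, (Fin n → 𝕜) →ₗ[𝕜] (Fin c.1.2 → 𝕜)}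
    (v : { v : Fin m → Fin n → 𝕜 // IsFramed T v }) {x : Fin m → ℙ 𝕜 (Fin n → 𝕜)}
    (hx : ∀ i, (x i).submodule = 𝕜 ∙ v.1 i) (hcon : p.IsConstructible (ofPoints x)) :
    (ofPoints x).Iso (p.rep (cramerParam v)) := by
  obtain ⟨S, hS, f, hf⟩ := hcon
  have hdim := fun y => (hS y).1
  refine Iso.trans ⟨f, hf⟩ (Iso.directSum fun y => ?_)
  by_cases hy : ∀ c, y ≠ .inr (.inr (.inr c))
  · exact iso_repSummand _ (hS y).2 (hS y).1 hy
  · push Not at hy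
    obtain ⟨c, rfl⟩ := hy
    have hsub := fun i => sub_eq_span_apply hf (hx i) (.inr (.inr (.inr c)))
    let G : (S (.inr (.inr (.inr c)))).V →ₗ[𝕜] (Fin c.1.2 → 𝕜) :=
      T c ∘ₗ f.symm.toLinearMap ∘ₗ LinearMap.single 𝕜 (fun y => (S y).V) (.inr (.inr (.inr c)))
    have hG : ∀ h, G (f (v.1 (enum c.1.1 h)) (.inr (.inr (.inr c)))) = T c (v.1 (enum c.1.1 h)) := by
      intro h
      have hmem : v.1 (enum c.1.1 h) ∈ (ofPoints x).sub (enum c.1.1 h) := by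
        change _ ∈ (x _).submodule
        rw [hx]
        exact Submodule.mem_span_singleton_self _
      exact congrArg (T c) (apply_eq_single hdim hf hmem (congrArg Sum.inr (p.blockOf_enum c h).symm))
    have hM : frameMatrix (p.lt_card c) G (fun i => f (v.1 i) (.inr (.inr (.inr c)))) =
        frameMatrix (p.lt_card c) (T c) v.1 := by
      ext k h
      exact congrFun (hG _) k
    refine iso_flagE_of_cramer (p.snd_pos c) (p.lt_card c) (finrank_V hdim _)
      (w := fun i => f (v.1 i) (.inr (.inr (.inr c)))) (fun i _ => hsub i)
      (fun i hi => sub_eq_bot hdim fun h => hi ?_) G ?_ ?_ ?_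
    · exact (p.mem_iff_of_K c i).2 (Sum.inr_injective h).symm
    · rw [hM]
      exact v.2.det_ne c
    · rw [hM, hG]
      exact v.2.unit_ne c
    · intro j h
      rw [hM, hG, hG]
      exact Projectivization.submodule_mk _ _

end Cramer

section Topology

open MultiFlag

variable {𝕜 : Type u} [RCLike 𝕜] {n m : ℕ} {p : SplitType n m}

theorem continuous_frameMatrix {K : Finset (Fin m)} {r : ℕ} (hrK : r < K.card)
    (T : (Fin n → 𝕜) →ₗ[𝕜] (Fin r → 𝕜)) :
    Continuous fun v : Fin m → Fin n → 𝕜 => frameMatrix hrK T v := by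
  have hT : Continuous T := LinearMap.continuous_of_finiteDimensional _
  exact continuous_matrix fun k h => (continuous_apply k).comp (hT.comp (continuous_apply _))

theorem continuous_frameMatrix_cramer {K : Finset (Fin m)} {r : ℕ} (hrK : r < K.card)
    (T : (Fin n → 𝕜) →ₗ[𝕜] (Fin r → 𝕜)) (i : Fin m) :
    Continuous fun v : Fin m → Fin n → 𝕜 => (frameMatrix hrK T v).cramer (T (v i)) := by
  have hT : Continuous T := LinearMap.continuous_of_finiteDimensional _
  exact (continuous_frameMatrix hrK T).matrix_cramer (hT.comp (continuous_apply i))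

theorem isOpen_isFramed (T : ∀ c : p.K, (Fin n → 𝕜) →ₗ[𝕜] (Fin c.1.2 → 𝕜)) :
    IsOpen { v | IsFramed T v } := by
  have : { v | IsFramed T v } =
      (⋂ c, { v | (frameMatrix (p.lt_card c) (T c) v).det ≠ 0 }) ∩
      ((⋂ c, ⋂ h, { v | (frameMatrix (p.lt_card c) (T c) v).cramer
        (T c (v (enum c.1.1 ⟨c.1.2, p.lt_card c⟩))) h ≠ 0 }) ∩
      ⋂ (c : p.K), ⋂ (j : Fin (c.1.1.card - c.1.2 - 1)),
        { v | (frameMatrix (p.lt_card c) (T c) v).cramer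
          (T c (v (enum c.1.1 ⟨c.1.2 + 1 + j, by omega⟩))) ≠ 0 }) := by
    ext v
    simp only [Set.mem_inter_iff, Set.mem_iInter, Set.mem_ofPred_eq]
    exact ⟨fun h => ⟨h.1, h.2, h.3⟩, fun h => ⟨h.1, h.2.1, h.2.2⟩⟩
  rw [this]
  refine (isOpen_iInter_of_finite fun c => ?_).inter ((isOpen_iInter_of_finite fun c =>
    isOpen_iInter_of_finite fun h => ?_).inter (isOpen_iInter_of_finite fun c =>
    isOpen_iInter_of_finite fun j => ?_))
  · exact isOpen_ne_fun (continuous_frameMatrix _ _).matrix_det continuous_const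
  · exact isOpen_ne_fun ((continuous_apply h).comp (continuous_frameMatrix_cramer _ _ _))
      continuous_const
  · exact isOpen_ne_fun (continuous_frameMatrix_cramer _ _ _) continuous_const

theorem continuous_cramerParam (T : ∀ c : p.K, (Fin n → 𝕜) →ₗ[𝕜] (Fin c.1.2 → 𝕜)) :
    Continuous (cramerParam (T := T)) := by
  refine continuous_pi fun c => continuous_pi fun j => Projectivization.continuous_mk'.comp ?_
  refine Continuous.subtype_mk (continuous_pi fun k => Continuous.div ?_ ?_ fun v => ?_) _
  · exact ((continuous_apply k).comp (continuous_frameMatrix_cramer _ _ _)).comp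
      continuous_subtype_val
  · exact ((continuous_apply k).comp (continuous_frameMatrix_cramer _ _ _)).comp
      continuous_subtype_val
  · exact v.2.unit_ne c k

/-- `T c` is the component of the isomorphism at the summand `E(K_c, r_c, q_c)`. There the first
vectors are multiples of the axis vectors, so the frame matrix is diagonal and invertible. -/
theorem exists_isFramed {x : Fin m → ℙ 𝕜 (Fin n → 𝕜)} {q : p.Param 𝕜}
    (h : (ofPoints x).Iso (p.rep q)) {v : Fin m → Fin n → 𝕜} (hv : ∀ i, v i ≠ 0)
    (hx : ∀ i, (x i).submodule = 𝕜 ∙ v i) :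
    ∃ T : ∀ c : p.K, (Fin n → 𝕜) →ₗ[𝕜] (Fin c.1.2 → 𝕜), IsFramed T v := by
  obtain ⟨f, hf⟩ : (ofPoints x).Iso (directSum (p.repSummand q)) := h
  let T : ∀ c : p.K, (Fin n → 𝕜) →ₗ[𝕜] (Fin c.1.2 → 𝕜) := fun c =>
    LinearMap.proj (φ := fun y => (p.repSummand q y).V) (.inr (.inr (.inr c))) ∘ₗ f.toLinearMap
  have hmem : ∀ i, v i ∈ (ofPoints x).sub i := fun i => by
    change _ ∈ (x i).submodule
    rw [hx]
    exact Submodule.mem_span_singleton_self _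
  have hTmem : ∀ c i, T c (v i) ∈ subE c.1.1 c.1.2 (q c) i := fun c i =>
    apply_mem (S := p.repSummand q) hf (hmem i) (.inr (.inr (.inr c)))
  have hTne : ∀ c h, T c (v (enum c.1.1 h)) ≠ 0 := by
    intro c h h0
    have h₁ := apply_eq_single (S := p.repSummand q) (p.repSummand_dim q) hf
      (hmem (enum c.1.1 h)) (congrArg Sum.inr (p.blockOf_enum c h).symm)
    have h₂ : f (v (enum c.1.1 h)) (.inr (.inr (.inr c))) = 0 := h0
    rw [h₂, Pi.single_zero] at h₁
    exact hv _ (h₁.symm.trans (map_zero f.symm))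
  have hframe : ∀ (c : p.K) (h : Fin c.1.2), ∃ a : 𝕜, a • Pi.single h (1 : 𝕜) =
      T c (v (enum c.1.1 ⟨h, h.2.trans (p.lt_card c)⟩)) := by
    intro c h
    have := hTmem c (enum c.1.1 ⟨h, h.2.trans (p.lt_card c)⟩)
    rw [subE_of_lt] at this
    exact Submodule.mem_span_singleton.1 this
  choose a ha using hframe
  have ha₀ : ∀ c h, a c h ≠ 0 := by
    intro c h h0
    refine hTne c ⟨h, h.2.trans (p.lt_card c)⟩ ?_
    rw [← ha, h0, zero_smul]
  have hM : ∀ c, frameMatrix (p.lt_card c) (T c) v = Matrix.diagonal (a c) := by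
    intro c
    ext k h
    have : frameMatrix (p.lt_card c) (T c) v k h = (a c h • Pi.single h (1 : 𝕜) : Fin c.1.2 → 𝕜) k := by
      rw [ha]
      rfl
    rw [this, Pi.smul_apply, smul_eq_mul]
    rcases eq_or_ne k h with rfl | hk
    · simp
    · rw [Pi.single_eq_of_ne hk, Matrix.diagonal_apply_ne _ hk, mul_zero]
  have hdet : ∀ c, (Matrix.diagonal (a c)).det ≠ 0 := by
    intro c
    rw [Matrix.det_diagonal]
    exact Finset.prod_ne_zero_iff.2 fun h _ => ha₀ c h
  refine ⟨T, fun c => ?_, fun c h => ?_, fun c j h0 => ?_⟩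
  · rw [hM]
    exact hdet c
  · rw [hM, cramer_diagonal (ha₀ c)]
    refine mul_ne_zero (hdet c) (div_ne_zero ?_ (ha₀ c h))
    have := hTmem c (enum c.1.1 ⟨c.1.2, p.lt_card c⟩)
    rw [subE_of_eq] at this
    obtain ⟨b, hb⟩ := Submodule.mem_span_singleton.1 this
    rw [← hb]
    intro hb0
    refine hTne c ⟨c.1.2, p.lt_card c⟩ ?_
    have hb0' : b = 0 := by simpa using hb0
    rw [← hb, hb0', zero_smul]
  · refine hTne c ⟨c.1.2 + 1 + j, by omega⟩ (funext fun k => ?_)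
    have := congrFun h0 k
    rw [hM, cramer_diagonal (ha₀ c)] at this
    exact (div_eq_zero_iff.1 ((mul_eq_zero.1 this).resolve_left (hdet c))).resolve_right (ha₀ c k)

/-- Near a point isomorphic to `F(p, q₀)`, every point of type `p` is isomorphic to `F(p, q)` for
some `q` near `q₀`. -/
theorem eventually_exists_iso_rep {x₀ : Fin m → ℙ 𝕜 (Fin n → 𝕜)} {q₀ : p.Param 𝕜}
    (h : (ofPoints x₀).Iso (p.rep q₀)) {O : Set (p.Param 𝕜)} (hO : O ∈ nhds q₀) :
    ∀ᶠ x in nhds x₀, p.IsConstructible (ofPoints x) → ∃ q ∈ O, (ofPoints x).Iso (p.rep q) := by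
  have hne : ∀ i, (x₀ i).rep ≠ 0 := fun i => (x₀ i).rep_nonzero
  obtain ⟨T, hT⟩ := exists_isFramed h hne fun i => (x₀ i).submodule_eq
  -- Injectivity of the parametrization identifies the Cramer parameters at `x₀` with `q₀`;
  -- continuity then keeps nearby parameters in `O`.
  have hq₀ : cramerParam ⟨_, hT⟩ = q₀ := rep_injective <|
    (iso_rep_cramerParam ⟨_, hT⟩ (fun i => (x₀ i).submodule_eq)
      ((p.rep_isConstructible q₀).of_iso h)).symm.trans h
  have hpre : cramerParam (T := T) ⁻¹' O ∈ nhds ⟨_, hT⟩ :=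
    (continuous_cramerParam T).continuousAt.preimage_mem_nhds (by rwa [hq₀])
  obtain ⟨N, hN, hNO⟩ := (mem_nhds_induced Subtype.val _ _).1 hpre
  refine Filter.mem_of_superset (Projectivization.mk_mem_nhds hne
    (fun i => (Projectivization.mk_rep (x₀ i)).symm)
    (Filter.inter_mem hN ((isOpen_isFramed T).mem_nhds hT))) ?_
  rintro _ ⟨w, ⟨hwN, hwT⟩, hw, rfl⟩ hcon
  exact ⟨cramerParam ⟨w, hwT⟩, hNO (a := ⟨w, hwT⟩) hwN,
    iso_rep_cramerParam ⟨w, hwT⟩ (fun i => Projectivization.submodule_mk _ _) hcon⟩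

end Topology

end SplitType

/-! ### Density of the image in the fibre -/

namespace SplitType

open MultiFlag

variable {𝕜 : Type u} [RCLike 𝕜] {n m : ℕ} {p : SplitType n m}

/-- Perturbing the vectors of a block in the direction of a projective frame makes them contain a
projective frame. -/
theorem exists_perturbation {V : Type u} [AddCommGroup V] [Module 𝕜 V] [FiniteDimensional 𝕜 V]
    {K : Finset (Fin m)} {r : ℕ} (hrK : r < K.card) (hV : Module.finrank 𝕜 V = r) (w : Fin m → V) :
    ∃ (u : Fin m → V) (G : V →ₗ[𝕜] (Fin r → 𝕜)), ∀ᶠ t in nhdsWithin (0 : 𝕜) {0}ᶜ,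
      (frameMatrix hrK G fun i => w i + t • u i).det ≠ 0 ∧
      ∀ h, (frameMatrix hrK G fun i => w i + t • u i).cramer
        (G (w (enum K ⟨r, hrK⟩) + t • u (enum K ⟨r, hrK⟩))) h ≠ 0 := by
  let β : Module.Basis (Fin r) 𝕜 V := Module.finBasisOfFinrankEq 𝕜 V hV
  let G : V →ₗ[𝕜] (Fin r → 𝕜) := β.equivFun.toLinearMap
  -- The direction of motion is a frame at positions up to `r`. The values beyond position `r` do
  -- not affect the claim; the value 0 outside `K` is a default.
  let u : Fin m → V := fun i => if hi : i ∈ K then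
      if h : (position K i hi : ℕ) < r then β ⟨position K i hi, h⟩ else ∑ h, β h
    else 0
  have hu₁ : ∀ h : Fin r, u (enum K ⟨h, h.2.trans hrK⟩) = β h := by
    intro h
    have hp : (position K (enum K ⟨h, h.2.trans hrK⟩) (enum_mem K _) : ℕ) = h :=
      congrArg Fin.val (position_enum K _)
    simp only [u]
    rw [dif_pos (enum_mem K _), dif_pos (by omega)]
    congr 1
    exact Fin.ext hp
  have hu₂ : u (enum K ⟨r, hrK⟩) = ∑ h, β h := by
    have hp : (position K (enum K ⟨r, hrK⟩) (enum_mem K _) : ℕ) = r :=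
      congrArg Fin.val (position_enum K _)
    simp only [u]
    rw [dif_pos (enum_mem K _), dif_neg (by omega)]
  have hGβ : ∀ h, G (β h) = Pi.single h 1 := by
    intro h
    funext k
    simp [G, Pi.single_apply, eq_comm]
  have hGsum : G (∑ h, β h) = fun _ => 1 := by
    rw [map_sum]
    simp only [hGβ]
    exact Finset.univ_sum_single fun _ => (1 : 𝕜)
  have hM : ∀ t : 𝕜, frameMatrix hrK G (fun i => w i + t • u i) = frameMatrix hrK G w + t • 1 := by
    intro t
    ext k h
    simp only [frameMatrix, Matrix.of_apply, Matrix.add_apply, Matrix.smul_apply, hu₁, map_add,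
      map_smul, hGβ, Pi.add_apply, Pi.smul_apply, Pi.single_apply, Matrix.one_apply]
  refine ⟨u, G, ?_⟩
  have h₁ := eventually_det_add_smul_ne_zero (frameMatrix hrK G w) 1 (by simp)
  -- Cramer's numerators are determinants with one column replaced. They are pencils in `t` as well,
  -- and their leading matrix, the identity with a column of ones, has determinant 1.
  have h₂ : ∀ᶠ t in nhdsWithin (0 : 𝕜) {0}ᶜ, ∀ h : Fin r,
      ((frameMatrix hrK G w).updateCol h (G (w (enum K ⟨r, hrK⟩))) +
        t • (1 : Matrix (Fin r) (Fin r) 𝕜).updateCol h fun _ => 1).det ≠ 0 := by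
    rw [Filter.eventually_all]
    intro h
    refine eventually_det_add_smul_ne_zero _ _ ?_
    rw [← Matrix.cramer_apply, Matrix.cramer_one]
    exact one_ne_zero
  filter_upwards [h₁, h₂] with t ht₁ ht₂
  rw [hM]
  refine ⟨ht₁, fun h => ?_⟩
  rw [Matrix.cramer_apply]
  convert ht₂ h using 2
  rw [map_add, map_smul, hu₂, hGsum]
  ext k l
  rcases eq_or_ne l h with rfl | hl
  · simp
  · simp [Matrix.updateCol_ne hl]

/-- The points isomorphic to some `F(p, q)` are dense among the points of type `p`. -/
theorem exists_iso_rep_mem {x₀ : Fin m → ℙ 𝕜 (Fin n → 𝕜)}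
    (h : p.IsConstructible (ofPoints x₀)) {N : Set (Fin m → ℙ 𝕜 (Fin n → 𝕜))}
    (hN : N ∈ nhds x₀) : ∃ x ∈ N, ∃ q, (ofPoints x).Iso (p.rep q) := by
  obtain ⟨S, hS, f, hf⟩ := h
  have hdim := fun y => (hS y).1
  obtain ⟨v, hv, hxv⟩ : ∃ v : Fin m → Fin n → 𝕜, ∃ hv : ∀ i, v i ≠ 0,
      ∀ i, x₀ i = Projectivization.mk 𝕜 (v i) (hv i) :=
    ⟨_, fun i => (x₀ i).rep_nonzero, fun i => (Projectivization.mk_rep (x₀ i)).symm⟩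
  have hsubx : ∀ i, (ofPoints x₀).sub i = 𝕜 ∙ v i := fun i => by
    change (x₀ i).submodule = _
    rw [hxv, Projectivization.submodule_mk]
  have hvmem : ∀ i, v i ∈ (ofPoints x₀).sub i := fun i => by
    rw [hsubx]
    exact Submodule.mem_span_singleton_self _
  have hpert := fun c : p.K => exists_perturbation (p.lt_card c)
    (finrank_V hdim (.inr (.inr c))) (fun i => f (v i) (.inr (.inr (.inr c))))
  choose u G huG using hpert
  -- Only the lines of the K-blocks move. Each displacement stays inside the summand of its own
  -- block, so the perturbed lines respect the old decomposition.
  let d : ∀ b : p.Block, Fin m → (S (.inr b)).V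
    | .inl _ => 0
    | .inr (.inl _) => 0
    | .inr (.inr c) => u c
  let e : Fin m → Fin n → 𝕜 := fun i =>
    f.symm (Pi.single (M := fun y => (S y).V) (.inr (p.blockOf i)) (d (p.blockOf i) i))
  have he : ∀ i y, y ≠ .inr (p.blockOf i) → f (e i) y = 0 := by
    intro i y hy
    simp only [e]
    rw [LinearEquiv.apply_symm_apply, Pi.single_eq_of_ne hy]
  have he' : ∀ i b, b = p.blockOf i → f (e i) (.inr b) = d b i := by
    rintro i _ rfl
    simp only [e]
    rw [LinearEquiv.apply_symm_apply, Pi.single_eq_same]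
  have hfadd : ∀ (t : 𝕜) i y, f (v i + t • e i) y = f (v i) y + t • f (e i) y := by
    intro t i y
    rw [map_add, map_smul]
    rfl
  have hcont : Filter.Tendsto (fun (t : 𝕜) i => v i + t • e i) (nhdsWithin 0 {0}ᶜ) (nhds v) := by
    have hc : Continuous fun (t : 𝕜) i => v i + t • e i :=
      continuous_pi fun i => continuous_const.add (continuous_id.smul continuous_const)
    have h0 : (fun i => v i + (0 : 𝕜) • e i) = v := by simp
    have := hc.tendsto 0
    rw [h0] at this
    exact this.mono_left nhdsWithin_le_nhds
  have hmem := hcont.eventually (Projectivization.eventually_mk_mem hv hxv hN)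
  have hne : ∀ᶠ w in nhds v, ∀ i, w i ≠ 0 := by
    rw [Filter.eventually_all]
    exact fun i => (continuous_apply i).continuousAt.eventually_ne (hv i)
  -- Being close to `x₀`, having non-zero vectors and containing a frame in every K-block all hold
  -- for small `t ≠ 0`.
  obtain ⟨t, htN, htne, htG⟩ := (hmem.and ((hcont.eventually hne).and
    (Filter.eventually_all.2 huG))).exists
  refine ⟨_, htN htne, ?_⟩
  have hsupp : ∀ i y, y ≠ .inr (p.blockOf i) → f (v i + t • e i) y = 0 := by
    intro i y hy
    rw [hfadd, he i y hy, apply_eq_zero hdim hf (hvmem i) hy, smul_zero, add_zero]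
  have hiso := iso_directSum_span
    (D := ofPoints fun i => Projectivization.mk 𝕜 (v i + t • e i) (htne i)) (fun y => (S y).V) f
    (fun i => v i + t • e i) (fun i => Projectivization.submodule_mk _ _)
    fun i => ⟨_, hsupp i⟩
  have hK : ∀ c : p.K, ∃ q, MultiFlag.Iso (𝕜 := 𝕜)
      { V := (S (.inr (.inr (.inr c)))).V,
        sub := fun i => 𝕜 ∙ f (v i + t • e i) (.inr (.inr (.inr c))) }
      (flagE c.1.1 c.1.2 q) := by
    intro c
    have hw : ∀ i ∈ c.1.1, f (v i + t • e i) (.inr (.inr (.inr c))) =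
        f (v i) (.inr (.inr (.inr c))) + t • u c i := by
      intro i hi
      rw [hfadd, he' i _ ((p.mem_iff_of_K c i).1 hi).symm]
    have hM : frameMatrix (p.lt_card c) (G c) (fun i => f (v i + t • e i) (.inr (.inr (.inr c)))) =
        frameMatrix (p.lt_card c) (G c)
          (fun i => f (v i) (.inr (.inr (.inr c))) + t • u c i) := by
      ext k h
      simp only [frameMatrix, Matrix.of_apply]
      rw [hw _ (enum_mem _ _)]
    refine exists_iso_flagE_of_cramer (p.snd_pos c) (p.lt_card c) (finrank_V hdim (.inr (.inr c)))
      (w := fun i => f (v i + t • e i) (.inr (.inr (.inr c)))) (fun i _ => rfl) (fun i hi => ?_)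
      (fun i hi h0 => ?_) (G c) ?_ ?_
    · have : f (v i + t • e i) (.inr (.inr (.inr c))) = 0 := hsupp i _ fun h =>
        hi ((p.mem_iff_of_K c i).2 (Sum.inr_injective h).symm)
      exact (congrArg (fun z => 𝕜 ∙ z) this).trans (Submodule.span_zero_singleton 𝕜)
    · refine htne i ((LinearEquiv.map_eq_zero_iff f).1 (funext fun y => ?_))
      rcases eq_or_ne y (.inr (p.blockOf i)) with rfl | hy
      · rw [(p.mem_iff_of_K c i).1 hi]
        exact h0
      · exact hsupp i y hy
    · rw [hM]
      exact (htG c).1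
    · rw [hM, hw _ (enum_mem _ _)]
      exact (htG c).2
  choose q hq using hK
  refine ⟨q, hiso.trans (Iso.directSum fun y => ?_)⟩
  have hd : ∀ y : p.Index, (∀ c, y ≠ .inr (.inr (.inr c))) → ∀ i, f (e i) y = 0 := by
    intro y hy i
    by_cases hyi : y = .inr (p.blockOf i)
    · rcases y with k | a | b | c
      · exact absurd hyi Sum.inl_ne_inr
      · exact he' i _ (Sum.inr_injective hyi)
      · exact he' i _ (Sum.inr_injective hyi)
      · exact absurd rfl (hy c)
    · exact he i y hyi
  by_cases hy : ∀ c, y ≠ .inr (.inr (.inr c))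
  · refine Iso.trans ⟨LinearEquiv.refl 𝕜 (S y).V, fun i => ?_⟩
      (iso_repSummand q (hS y).2 (hS y).1 hy)
    refine (Submodule.map_id _).trans ?_
    change 𝕜 ∙ f (v i + t • e i) y = _
    rw [sub_eq_span_apply hf (hsubx i), hfadd, hd y hy, smul_zero, add_zero]
  · push Not at hy
    obtain ⟨c, rfl⟩ := hy
    exact hq c

end SplitType

/-! ### The projection π and the embedding ι -/

theorem theorem2p2 {𝕜 : Type u} [RCLike 𝕜] (n m : ℕ) (hn : 2 ≤ n) (hm : 1 ≤ m) :
    ∃ π : OrbitSpace 𝕜 n m → SplitType n m,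
      (∀ (x : Fin m → ℙ 𝕜 (Fin n → 𝕜)) (p : SplitType n m),
        π (orbitOf x) = p ↔ p.IsConstructible (MultiFlag.ofPoints x)) ∧
      Function.Surjective π ∧
      ∀ p : SplitType n m,
        ∃ ι : p.Param 𝕜 → (π ⁻¹' {p} : Set (OrbitSpace 𝕜 n m)),
          (∀ (q : p.Param 𝕜) (x : Fin m → ℙ 𝕜 (Fin n → 𝕜)),
            (ι q : OrbitSpace 𝕜 n m) = orbitOf x ↔ (MultiFlag.ofPoints x).Iso (p.rep q)) ∧
          Topology.IsOpenEmbedding ι ∧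
          DenseRange ι ∧
          (p.K = ∅ →
            (∃! O : OrbitSpace 𝕜 n m, π O = p) ∧ Nonempty (Unique (p.Param 𝕜)) ∧
              Function.Bijective ι) := by
  have hex : ∀ x : Fin m → ℙ 𝕜 (Fin n → 𝕜), ∃! p : SplitType n m,
      p.IsConstructible (MultiFlag.ofPoints x) := fun x =>
    SplitType.existsUnique_isConstructible (Module.finrank_fin_fun 𝕜)
      fun i => (x i).finrank_submodule
  have hsurj : ∀ O : OrbitSpace 𝕜 n m, ∃ x, orbitOf x = O := Quotient.exists_rep
  choose pt hpt using hsurj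
  -- The type of an arbitrary representative; isomorphism invariance of constructibility removes the
  -- dependence on the choice.
  let π : OrbitSpace 𝕜 n m → SplitType n m := fun O => (hex (pt O)).choose
  have hπ : ∀ (x : Fin m → ℙ 𝕜 (Fin n → 𝕜)) (p : SplitType n m),
      π (orbitOf x) = p ↔ p.IsConstructible (MultiFlag.ofPoints x) := by
    intro x p
    have hiso := orbitOf_eq_iff.1 (hpt (orbitOf x))
    have hspec := (hex (pt (orbitOf x))).choose_spec
    constructor
    · rintro rfl
      exact hspec.1.of_iso hiso.symm
    · exact fun h => (hspec.2 p (h.of_iso hiso)).symm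
  choose X hXc hX using fun p : SplitType n m => p.exists_continuous_points (𝕜 := 𝕜)
  have hπX : ∀ p q, π (orbitOf (X p q)) = p := fun p q =>
    (hπ _ _).2 ((p.rep_isConstructible q).of_iso (hX p q))
  refine ⟨π, hπ, fun p => ⟨_, hπX p (Classical.arbitrary _)⟩, fun p => ?_⟩
  let ι : p.Param 𝕜 → (π ⁻¹' {p} : Set (OrbitSpace 𝕜 n m)) := fun q =>
    ⟨orbitOf (X p q), hπX p q⟩
  have hι : ∀ (q : p.Param 𝕜) (x : Fin m → ℙ 𝕜 (Fin n → 𝕜)),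
      (ι q : OrbitSpace 𝕜 n m) = orbitOf x ↔ (MultiFlag.ofPoints x).Iso (p.rep q) := by
    intro q x
    refine orbitOf_eq_iff.trans ⟨fun h => h.symm.trans (hX p q), fun h => (hX p q).trans h.symm⟩
  have hinj : Function.Injective ι := by
    intro q q' h
    have h₁ := (hι q (X p q')).1 (congrArg Subtype.val h)
    exact SplitType.rep_injective (h₁.symm.trans (hX p q'))
  have hcont : Continuous ι := (continuous_orbitOf.comp (hXc p)).subtype_mk _
  have hopen : IsOpenMap ι := by
    intro O hO
    rw [isOpen_iff_mem_nhds]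
    rintro _ ⟨q, hq, rfl⟩
    -- A neighbourhood of the point upstairs maps onto a neighbourhood of the orbit, since the orbit
    -- map is open. Intersected with the fibre over `p`, it consists of values of ι on `O`.
    have hN := SplitType.eventually_exists_iso_rep (hX p q) (hO.mem_nhds hq)
    have hN' := continuous_subtype_val.continuousAt.preimage_mem_nhds
      (x := ι q) (isOpenMap_orbitOf.image_mem_nhds hN)
    refine Filter.mem_of_superset hN' ?_
    rintro ⟨_, hp⟩ ⟨x, hx, rfl⟩
    obtain ⟨q', hq', hiso⟩ := hx ((hπ x p).1 hp)
    exact ⟨q', hq', Subtype.ext ((hι q' x).2 hiso)⟩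
  have hdense : DenseRange ι := by
    rintro ⟨o, ho⟩
    obtain ⟨x, rfl⟩ : ∃ x, orbitOf x = o := ⟨_, hpt o⟩
    rw [mem_closure_iff_nhds]
    intro t ht
    obtain ⟨N, hN, hNt⟩ := (mem_nhds_induced Subtype.val _ _).1 ht
    obtain ⟨y, hy, q, hiso⟩ := SplitType.exists_iso_rep_mem ((hπ x p).1 ho)
      (continuous_orbitOf.continuousAt.preimage_mem_nhds hN)
    refine ⟨ι q, hNt ?_, q, rfl⟩
    have : (ι q : OrbitSpace 𝕜 n m) = orbitOf y := (hι q y).2 hiso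
    rw [Set.mem_preimage, this]
    exact hy
  refine ⟨ι, hι, .of_continuous_injective_isOpenMap hcont hinj hopen, hdense, fun hK => ?_⟩
  have hempty : IsEmpty p.K := by
    rw [hK]
    infer_instance
  -- Without K-blocks there is only the empty parameter, and every summand is determined by its
  -- dimension.
  have hex_iso : ∀ x : Fin m → ℙ 𝕜 (Fin n → 𝕜), p.IsConstructible (MultiFlag.ofPoints x) →
      (MultiFlag.ofPoints x).Iso (p.rep (𝕜 := 𝕜) isEmptyElim) := by
    rintro x ⟨S, hS, hiso⟩
    refine hiso.trans (MultiFlag.Iso.directSum fun y => ?_)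
    exact SplitType.iso_repSummand _ (hS y).2 (hS y).1 fun c => isEmptyElim c
  have huniq : ∀ O : OrbitSpace 𝕜 n m, π O = p → O = ι isEmptyElim := by
    intro O hO
    obtain ⟨x, rfl⟩ : ∃ x, orbitOf x = O := ⟨_, hpt O⟩
    exact ((hι _ x).2 (hex_iso x ((hπ x p).1 hO))).symm
  exact ⟨⟨_, (ι isEmptyElim).2, huniq⟩, ⟨Pi.uniqueOfIsEmpty _⟩, hinj,
    fun O => ⟨isEmptyElim, Subtype.ext (huniq O.1 O.2).symm⟩⟩
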